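/- Let $K\ge 1$ and let $p^{(0)}=(p^{(0)}_1,\dots,p^{(0)}_K)$ have positive entries with sum $1$. Consider a sequence of finite populations of sizes $N$; unit $i$ of a population has a category $y_i\in\{1,\dots,K\}$ and an inclusion probability $\pi_i\in[0,1]$. Both may be random, and $\pi_i$ may depend on $y_i$; the pairs $(y_i,\pi_i)$ are independent over the units of a population (fixed populations with fixed $\pi_i$ are included). Given the population, a sample $A$ is drawn by Poisson sampling: the units are selected independently, unit $i$ with probability $\pi_i$. Let $n=|A|$, $w_i=\pi_i^{-1}$, $n_0=E\sum_{i=1}^N\pi_i$, and $$\hat p_k=\frac{\sum_{i\in A,\,y_i=k}w_i}{\sum_{i\in A}w_i}.$$ Given $A$, the bootstrap weights are $w_i^*=w_im_i^*$ $(i\in A)$, where $(N_i^*)_{i\in A}$ is multinomial with $N$ trials and probabilities proportional to $w_i$ and, given $(N_i^*)$, the $m_i^*\sim\mathrm{Bin}(N_i^*,\pi_i)$ are independent. Let $\hat p^*_k$ be $\hat p_k$ with $w_i$ replaced by $w_i^*$, and put $$X^{2*}(\hat p)=n\sum_{k=1}^K\frac{(\hat p^*_k-\hat p_k)^2}{\hat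 p_k},\qquad W^*(\hat p)=2n\sum_{k=1}^K\hat p^*_k\log\frac{\hat p^*_k}{\hat p_k}.$$ Suppose that, along the sequence, $n_0\to\infty$ and $n_0/N\to0$; that $C_1\le N n_0^{-1}\pi_i\le C_2$ almost surely for all $i$ with constants $C_1,C_2>0$; that the null hypothesis holds, at least in the limit: $N^{-1}\sum_{i=1}^N P(y_i=k)\to p^{(0)}_k$ for every $k$ (in particular if these means, or the population proportions $N_k/N$ of a fixed population, are equal to $p^{(0)}_k$); and that the asymptotic covariance matrix $\Sigma_p$ of $\sqrt n\,(\hat p_1,\dots,\hat p_{K-1})^{\mathrm T}$ exists, as the limit of $n_0$ times the covariance matrix of the linearized errors $$\frac1N\sum_{i\in A}w_i\bigl(1\{y_i=k\}-p^{(0)}_k\bigr),\qquad k=1,\dots,K-1.$$ Let $P_0=\bigl(p^{(0)}_k1\{k=l\}-p^{(0)}_kp^{(0)}_l\bigr)_{k,l=1}^{K-1}$. Then the eigenvalues $\lambda_1\le\dots\le\lambda_{K-1}$ (with multiplicity) of the design-effect matrix $P_0^{-1}\Sigma_p$ are real, and, conditionally on $A$, both $X^{2*}(\hat p)$ and $W^*(\hat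 p)$ converge in distribution to $$\mathcal G_2=\sum_{k=1}^{K-1}\lambda_kZ_k^2,\qquad Z_1,\dots,Z_{K-1}\ \text{i.i.d.}\ N(0,1).$$ That is, for every bounded continuous $f:\mathbb R\to\mathbb R$, $E\{f(X^{2*}(\hat p))\mid A\}\to E f(\mathcal G_2)$ and $E\{f(W^*(\hat p))\mid A\}\to E f(\mathcal G_2)$ in probability. -/

import Mathlib

open MeasureTheory ProbabilityTheory Filter Topology Finset
open scoped BigOperators Polynomial

noncomputable section

namespace SurveyBootstrap

/-- `w_i = 1 / π_i`, the sampling weights. -/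
def samplingWeight {N : ℕ} (π : Fin N → unitInterval) (i : Fin N) : ℝ := (π i : ℝ)⁻¹

/-- The weighted proportion of category `k` in the sample `A`:
`(∑_{i ∈ A, y_i = k} w_i) / (∑_{i ∈ A} w_i)`. -/
def weightedProportion {N K : ℕ} (A : Finset (Fin N)) (y : Fin N → Fin K) (w : Fin N → ℝ)
    (k : Fin K) : ℝ :=
  (∑ i ∈ A with y i = k, w i) / ∑ i ∈ A, w i

/-- The Pearson statistic `n ∑_k (q_k - p_k)² / p_k`. -/
def pearsonStat {K : ℕ} (n : ℕ) (q p : Fin K → ℝ) : ℝ :=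
  n * ∑ k, (q k - p k) ^ 2 / p k

/-- The likelihood ratio statistic `2 n ∑_k q_k log (q_k / p_k)` (with `0 log 0 = 0`). -/
def lrStat {K : ℕ} (n : ℕ) (q p : Fin K → ℝ) : ℝ :=
  2 * n * ∑ k, q k * Real.log (q k / p k)

/-! ### The sampling design -/

/-- `n₀ = E (∑_i π_i)`, the expected sample size. -/
def expectedSize {Ω : Type*} [MeasurableSpace Ω] (P : Measure Ω) {N : ℕ}
    (π : Fin N → Ω → unitInterval) : ℝ :=
  ∑ i, ∫ ω, (π i ω : ℝ) ∂P

/-- Poisson sampling: given the finite population `(y_i, π_i)_{i}`, the random sample `A` contains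
the units independently of each other, unit `i` with probability `π_i`, so that
`P (A = s | population) = ∏_{i ∈ s} π_i ∏_{i ∉ s} (1 - π_i)`. -/
def IsPoissonSample {Ω : Type*} [MeasurableSpace Ω] (P : Measure Ω) {N K : ℕ}
    (y : Fin N → Ω → Fin K) (π : Fin N → Ω → unitInterval) (A : Ω → Finset (Fin N)) : Prop :=
  (∀ s : Finset (Fin N), MeasurableSet (A ⁻¹' {s})) ∧
  ∀ s : Finset (Fin N),
    P⟦A ⁻¹' {s} | MeasurableSpace.comap (fun ω i => (y i ω, π i ω)) inferInstance⟧ =ᵐ[P]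
      fun ω => (∏ i ∈ s, (π i ω : ℝ)) * ∏ i ∈ sᶜ, (1 - (π i ω : ℝ))

/-- `N⁻¹ ∑_{i ∈ A} w_i (1{y_i = k} - p_k)`. The error `p̂_k - p_k` of the estimated proportion
`p̂_k` is this sum divided by `N⁻¹ ∑_{i ∈ A} w_i`, whose limit is `1`. -/
def linearizedError {N K : ℕ} (p : Fin K → ℝ) (A : Finset (Fin N)) (y : Fin N → Fin K)
    (π : Fin N → unitInterval) (k : Fin K) : ℝ :=
  (N : ℝ)⁻¹ * ∑ i ∈ A, samplingWeight π i * ((if y i = k then 1 else 0) - p k)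

/-! ### The bootstrap weights -/

/-- The law on the sample `A` that gives unit `i` the probability `w_i / ∑_{j ∈ A} w_j`. -/
def drawLaw {N : ℕ} (A : Finset (Fin N)) (w : Fin N → ℝ) : Measure (Fin N) :=
  ∑ i ∈ A, ENNReal.ofReal (w i / ∑ j ∈ A, w j) • Measure.dirac i

/-- The multinomial law with `M` trials: the law of the vector of counts of `M` independent draws
from `ρ`. -/
def multinomialLaw {N : ℕ} (M : ℕ) (ρ : Measure (Fin N)) : Measure (Fin N → ℕ) :=
  (Measure.pi fun _ : Fin M => ρ).map fun c i => #{j | c j = i}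

/-- The bootstrap law, given the sample, of the multiplicities `m* = (m*_i)`: first
`(N*_i)_{i ∈ A}` is multinomial with `N` trials and probabilities proportional to `w_i`, then
`m*_i ∼ Bin(N*_i, π_i)` independently. Units outside `A` have `N*_i = m*_i = 0`. -/
def bootstrapLaw {N : ℕ} (A : Finset (Fin N)) (π : Fin N → unitInterval) :
    Measure (Fin N → ℕ) :=
  (multinomialLaw N (drawLaw A (samplingWeight π))).bind fun Nstar =>
    Measure.pi fun i => binomial (Nstar i) (π i)

/-- The estimated proportions `p̂_k`. -/
def estProportion {N K : ℕ} (A : Finset (Fin N)) (y : Fin N → Fin K)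
    (π : Fin N → unitInterval) : Fin K → ℝ :=
  weightedProportion A y (samplingWeight π)

/-- The bootstrap proportions `p̂*_k`, computed with the bootstrap weights `w*_i = w_i m*_i`. -/
def bootProportion {N K : ℕ} (A : Finset (Fin N)) (y : Fin N → Fin K)
    (π : Fin N → unitInterval) (m : Fin N → ℕ) : Fin K → ℝ :=
  weightedProportion A y fun i => samplingWeight π i * m i

/-- The conditional law, given the sample, of `X²*(p̂) = n ∑_k (p̂*_k - p̂_k)² / p̂_k`, where `n` is
the size of the sample. -/
def bootPearsonLaw {N K : ℕ} (A : Finset (Fin N)) (y : Fin N → Fin K)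
    (π : Fin N → unitInterval) : Measure ℝ :=
  (bootstrapLaw A π).map fun m =>
    pearsonStat #A (bootProportion A y π m) (estProportion A y π)

/-- The conditional law, given the sample, of `W*(p̂) = 2 n ∑_k p̂*_k log (p̂*_k / p̂_k)`. -/
def bootLRLaw {N K : ℕ} (A : Finset (Fin N)) (y : Fin N → Fin K)
    (π : Fin N → unitInterval) : Measure ℝ :=
  (bootstrapLaw A π).map fun m =>
    lrStat #A (bootProportion A y π m) (estProportion A y π)

/-! ### The limit -/

/-- `P₀ = diag(p) - p pᵀ`, for the first `K - 1 = d` proportions. -/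
def multinomialCov {d : ℕ} (p : Fin (d + 1) → ℝ) : Matrix (Fin d) (Fin d) ℝ :=
  Matrix.diagonal (fun k => p k.castSucc) -
    Matrix.vecMulVec (fun k => p k.castSucc) (fun k => p k.castSucc)

/-- The law of `∑_k l_k Z_k²`, where the `Z_k` are independent standard normal variables. -/
def weightedChiSq {d : ℕ} (l : Fin d → ℝ) : Measure ℝ :=
  (Measure.pi fun _ : Fin d => gaussianReal 0 1).map fun z => ∑ k, l k * z k ^ 2

/-- The random laws `μ_t` on `ℝ` converge weakly to `ν` in probability: for every bounded
continuous `f`, `∫ f dμ_t → ∫ f dν` in probability. With `μ_t` the conditional law of a statistic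
given the sample, this is convergence in distribution conditionally on the sample. -/
def TendstoWeaklyInProbability {Ω : ℕ → Type*} [∀ t, MeasurableSpace (Ω t)]
    (P : ∀ t, Measure (Ω t)) (μ : ∀ t, Ω t → Measure ℝ) (ν : Measure ℝ) : Prop :=
  ∀ f : BoundedContinuousFunction ℝ ℝ, ∀ ε : ℝ, 0 < ε →
    Tendsto (fun t => P t {ω | ε ≤ |∫ x, f x ∂(μ t ω) - ∫ x, f x ∂ν|}) atTop (𝓝 0)

end SurveyBootstrap

end

noncomputable section

namespace SurveyBootstrap

/-! ### The probability generating function of the bootstrap multiplicities -/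

/-! Write W for the sum of w_i over A. One bootstrap trial draws unit i with probability w_i / W and
keeps it with probability π_i. Since w_i π_i = 1, it yields a copy of i with probability 1 / W, the
same for all i in A, and otherwise nothing. Hence m* has generating function (1 + ∑_A (z_i - 1) /
W)^N (`integral_prod_pow_bootstrapLaw`), and ∑ m*_i v_i is a sum of N i.i.d. vectors. If the v_i are
uniformly small and N / W times their first and second moment sums converge, the characteristic
functions converge to a Gaussian one (`tendsto_integral_bootstrap_sum`).

Take v_i = `bootVec`, and let (R, u, D) be the resulting sum. If D ≠ 0 and all p̂_k > 0, both
statistics equal ∑_k (R_k / D)² h(u_k / D), with h = 1 for Pearson and h = `lrRatio` for the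
likelihood ratio. Since u_k and D tend to 1 and h(1) = 1, both have the limit |GZ|², where GGᵀ is
the limiting covariance of R.

That covariance comes from the sums n N⁻² ∑_A w_i² (1{y_i = k} - p̂_k)(1{y_i = l} - p̂_l). Under
Poisson sampling of independent units, the covariance of ∑_A φ_i and ∑_A ψ_i is ∑_i (E π_i φ_i ψ_i -
E π_i φ_i E π_i ψ_i). For the linearized errors the subtracted products, times n₀, are at most n₀ /
N and vanish in the limit. So `errorMoment` has mean tending to Σ_p, and Chebyshev's inequality
gives convergence in probability.

For the eigenvalues, F = `scaledExt p` satisfies FᵀF = P₀⁻¹. Write Σ_p = HHᵀ and let U diagonalize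
HᵀP₀⁻¹H, which has the characteristic polynomial of P₀⁻¹Σ_p. With G = FHU, GGᵀ = FΣ_pFᵀ and GᵀG =
diag(λ), so |GZ|² = ∑ λ_k Z_k² (`exists_designEffect_eigenvalues`).

The sample matters only through finitely many quantities that converge in probability: its size, the
category weights and the error moments. `tendsto_measure_of_forall_seq` therefore reduces the claim
to deterministic sequences of samples (`tendsto_integral_bootLaws`). -/

theorem integral_pow_binomial (n : ℕ) (p : unitInterval) (z : ℂ) :
    ∫ k, z ^ k ∂(binomial n p) = (1 - (p : ℝ) + (p : ℝ) * z) ^ n := by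
  rw [integral_binomial, add_comm, add_pow]
  have : Finset.Iic n = Finset.range (n + 1) := by
    ext; simp
  rw [this]
  refine Finset.sum_congr rfl fun k _ => ?_
  rw [Complex.real_smul]
  push_cast
  ring

/-- The integral against the mixture of a kernel `κ` over `μ` is an iterated integral. -/
theorem integral_bind_kernel {α β : Type*} [MeasurableSpace α] [MeasurableSpace β]
    (μ : Measure α) (κ : Kernel α β) {f : β → ℂ} (hf : Integrable f (μ.bind κ)) :
    ∫ x, f x ∂(μ.bind κ) = ∫ a, ∫ x, f x ∂(κ a) ∂μ := by
  have h := Kernel.integral_comp (η := κ) (κ := Kernel.const Unit μ) (a := ()) (f := f)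
  rw [Kernel.comp_apply, Kernel.const_apply] at h
  exact h hf

section

variable {N : ℕ}

theorem isProbabilityMeasure_drawLaw (A : Finset (Fin N)) (w : Fin N → ℝ) (hw : ∀ i, 0 ≤ w i)
    (hW : 0 < ∑ i ∈ A, w i) : IsProbabilityMeasure (drawLaw A w) := by
  constructor
  simp only [drawLaw, Measure.coe_finsetSum, Measure.coe_smul, Finset.sum_apply, Pi.smul_apply,
    measure_univ, smul_eq_mul, mul_one]
  rw [← ENNReal.ofReal_sum_of_nonneg fun i _ => div_nonneg (hw i) hW.le, ← Finset.sum_div,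
    div_self hW.ne', ENNReal.ofReal_one]

theorem integral_drawLaw (A : Finset (Fin N)) (w : Fin N → ℝ) (hw : ∀ i, 0 ≤ w i)
    (hW : 0 < ∑ i ∈ A, w i) (f : Fin N → ℂ) :
    ∫ i, f i ∂(drawLaw A w) = ∑ i ∈ A, ((w i / ∑ j ∈ A, w j : ℝ) : ℂ) * f i := by
  have hfin : ∀ i, IsFiniteMeasure
      (ENNReal.ofReal (w i / ∑ j ∈ A, w j) • (Measure.dirac i : Measure (Fin N))) :=
    fun i => Measure.smul_finite _ ENNReal.ofReal_ne_top
  rw [drawLaw, integral_finsetSum_measure fun i _ => Integrable.of_finite]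
  refine Finset.sum_congr rfl fun i _ => ?_
  rw [integral_smul_measure, integral_dirac,
    ENNReal.toReal_ofReal (div_nonneg (hw i) hW.le), Complex.real_smul]

theorem isProbabilityMeasure_multinomialLaw (M : ℕ) (ρ : Measure (Fin N)) [IsProbabilityMeasure ρ] :
    IsProbabilityMeasure (multinomialLaw M ρ) :=
  Measure.isProbabilityMeasure_map Measurable.of_discrete.aemeasurable

/-- Regrouping by draws instead of by units turns the integrand into a product over the `M`
independent draws. -/
theorem integral_prod_pow_multinomialLaw (M : ℕ) (ρ : Measure (Fin N)) [IsProbabilityMeasure ρ]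
    (g : Fin N → ℂ) :
    ∫ n, ∏ i, g i ^ n i ∂(multinomialLaw M ρ) = (∫ i, g i ∂ρ) ^ M := by
  rw [multinomialLaw, integral_map Measurable.of_discrete.aemeasurable
    Measurable.of_discrete.aestronglyMeasurable]
  have : ∀ c : Fin M → Fin N, ∏ i, g i ^ #{j | c j = i} = ∏ j, g (c j) := by
    intro c
    rw [← Finset.prod_fiberwise' Finset.univ c g]
    simp [Finset.prod_const]
  simp_rw [this]
  rw [integral_fintype_prod_eq_pow, Fintype.card_fin]

/-- The kernel `(N*_i) ↦ ⨂ Bin(N*_i, π_i)`. -/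
def thinningKernel (π : Fin N → unitInterval) : Kernel (Fin N → ℕ) (Fin N → ℕ) where
  toFun n := Measure.pi fun i => binomial (n i) (π i)
  measurable' := Measurable.of_discrete

instance (π : Fin N → unitInterval) : IsMarkovKernel (thinningKernel π) :=
  ⟨fun n => by change IsProbabilityMeasure (Measure.pi _); infer_instance⟩

theorem bootstrapLaw_eq (A : Finset (Fin N)) (π : Fin N → unitInterval) :
    bootstrapLaw A π =
      (multinomialLaw N (drawLaw A (samplingWeight π))).bind (thinningKernel π) := rfl

theorem samplingWeight_nonneg (π : Fin N → unitInterval) (i : Fin N) : 0 ≤ samplingWeight π i :=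
  inv_nonneg.2 (π i).2.1

theorem isProbabilityMeasure_bootstrapLaw (A : Finset (Fin N)) (π : Fin N → unitInterval)
    (hW : 0 < ∑ i ∈ A, samplingWeight π i) : IsProbabilityMeasure (bootstrapLaw A π) := by
  have := isProbabilityMeasure_drawLaw A _ (samplingWeight_nonneg π) hW
  have := isProbabilityMeasure_multinomialLaw N (drawLaw A (samplingWeight π))
  rw [bootstrapLaw_eq]
  infer_instance

/-- Thinning replaces z_i by 1 - π_i + π_i z_i in the multinomial generating function. Averaging
over i with weights w_i / W leaves 1 + ∑ (z_i - 1) / W, because w_i π_i = 1: the unequal inclusion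
probabilities cancel. -/
theorem integral_prod_pow_bootstrapLaw (A : Finset (Fin N)) (π : Fin N → unitInterval)
    (hW : 0 < ∑ i ∈ A, samplingWeight π i) (hπ : ∀ i ∈ A, 0 < (π i : ℝ))
    (z : Fin N → ℂ) (hz : ∀ i, ‖z i‖ ≤ 1) :
    ∫ m, ∏ i, z i ^ m i ∂(bootstrapLaw A π) =
      (1 + (∑ i ∈ A, (z i - 1)) / ((∑ i ∈ A, samplingWeight π i : ℝ) : ℂ)) ^ N := by
  have hprob := isProbabilityMeasure_bootstrapLaw A π hW
  have := isProbabilityMeasure_drawLaw A _ (samplingWeight_nonneg π) hW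
  have hW' : ((∑ i ∈ A, samplingWeight π i : ℝ) : ℂ) ≠ 0 := by exact_mod_cast hW.ne'
  have hint : Integrable (fun m : Fin N → ℕ => ∏ i, z i ^ m i) (bootstrapLaw A π) := by
    refine Integrable.of_bound Measurable.of_discrete.aestronglyMeasurable 1
      (ae_of_all _ fun m => ?_)
    rw [norm_prod]
    refine Finset.prod_le_one (fun i _ => norm_nonneg _) fun i _ => ?_
    rw [norm_pow]
    exact pow_le_one₀ (norm_nonneg _) (hz i)
  rw [bootstrapLaw_eq] at hint ⊢
  rw [integral_bind_kernel _ _ hint]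
  have hin : ∀ n : Fin N → ℕ, ∫ m, ∏ i, z i ^ m i ∂(thinningKernel π n) =
      ∏ i, (1 - ((π i : ℝ) : ℂ) + (π i : ℝ) * z i) ^ n i := by
    intro n
    change ∫ m, ∏ i, z i ^ m i ∂(Measure.pi fun i => binomial (n i) (π i)) = _
    rw [integral_fintype_prod_eq_prod (f := fun i (k : ℕ) => z i ^ k)]
    simp_rw [integral_pow_binomial]
  simp_rw [hin]
  rw [integral_prod_pow_multinomialLaw, integral_drawLaw A _ (samplingWeight_nonneg π) hW]
  congr 1
  have hterm : ∀ i ∈ A, ((samplingWeight π i / ∑ j ∈ A, samplingWeight π j : ℝ) : ℂ) *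
      (1 - ((π i : ℝ) : ℂ) + (π i : ℝ) * z i) =
      (samplingWeight π i : ℂ) / ((∑ j ∈ A, samplingWeight π j : ℝ) : ℂ) +
      (z i - 1) / ((∑ j ∈ A, samplingWeight π j : ℝ) : ℂ) := by
    intro i hi
    have h1 : ((π i : ℝ) : ℂ) ≠ 0 := by exact_mod_cast (hπ i hi).ne'
    have h2 : (samplingWeight π i : ℂ) * ((π i : ℝ) : ℂ) = 1 := by
      rw [samplingWeight, Complex.ofReal_inv, inv_mul_cancel₀ h1]
    rw [Complex.ofReal_div]
    linear_combination ((z i - 1) / ((∑ j ∈ A, samplingWeight π j : ℝ) : ℂ)) * h2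
  rw [Finset.sum_congr rfl hterm, Finset.sum_add_distrib, ← Finset.sum_div, ← Finset.sum_div,
    ← Complex.ofReal_sum, div_self hW']

end

/-! ### The statistics as functions of a linear function of the multiplicities -/

open InformationTheory in
/-- The continuous function `h` with `2 (r log r + 1 - r) = (r - 1)² h(r)` and `h(1) = 1`. -/
def lrRatio : ℝ → ℝ := Function.update (fun r => 2 * klFun r / (r - 1) ^ 2) 1 1

theorem lrRatio_one : lrRatio 1 = 1 := by simp [lrRatio]

open InformationTheory in
theorem two_mul_klFun (r : ℝ) : 2 * klFun r = (r - 1) ^ 2 * lrRatio r := by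
  by_cases h : r = 1
  · simp [h, klFun_one]
  · have : r - 1 ≠ 0 := sub_ne_zero.2 h
    rw [lrRatio, Function.update_of_ne h]
    field_simp

-- Only the point 1 needs an argument. There L'Hôpital's rule reduces the quotient to log r / (r -
-- 1), a difference quotient of log at 1.
open InformationTheory in
theorem continuous_lrRatio : Continuous lrRatio := by
  rw [continuous_iff_continuousAt]
  intro r
  by_cases h : r = 1
  · subst h
    rw [lrRatio, continuousAt_update_same]
    have hlog : Tendsto (fun r : ℝ => 2 * Real.log r / (2 * (r - 1))) (𝓝[≠] 1) (𝓝 1) := by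
      have h1 := (Real.hasDerivAt_log one_ne_zero).tendsto_slope
      simp only [slope_fun_def_field, Real.log_one, sub_zero, inv_one] at h1
      refine h1.congr fun r => ?_
      rw [mul_div_mul_left _ _ two_ne_zero]
    refine HasDerivAt.lhopital_zero_nhdsNE (f' := fun r => 2 * Real.log r)
      (g' := fun r => 2 * (r - 1)) ?_ ?_ ?_ ?_ ?_ hlog
    · have : ∀ᶠ r : ℝ in 𝓝 1, r ≠ 0 := eventually_ne_nhds one_ne_zero
      filter_upwards [nhdsWithin_le_nhds this] with r hr
      exact (hasDerivAt_klFun hr).const_mul 2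
    · refine Eventually.of_forall fun r => ?_
      have := (((hasDerivAt_id r).sub_const 1).fun_pow 2).congr_deriv
        (show _ = 2 * (r - 1) by simp)
      exact this
    · filter_upwards [self_mem_nhdsWithin] with r hr
      exact mul_ne_zero two_ne_zero (sub_ne_zero.2 hr)
    · have : Continuous fun r : ℝ => 2 * klFun r := continuous_klFun.const_mul 2
      have := this.tendsto 1
      rw [klFun_one, mul_zero] at this
      exact this.mono_left nhdsWithin_le_nhds
    · have : Continuous fun r : ℝ => (r - 1) ^ 2 := by fun_prop
      have := this.tendsto 1
      simp only [sub_self, ne_eq, OfNat.ofNat_ne_zero, not_false_eq_true, zero_pow] at this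
      exact this.mono_left nhdsWithin_le_nhds
  · have hc : ContinuousAt (fun r : ℝ => 2 * klFun r / (r - 1) ^ 2) r :=
      (continuous_klFun.continuousAt.const_mul 2).div (by fun_prop)
        (pow_ne_zero 2 (sub_ne_zero.2 h))
    exact hc.congr (by
      filter_upwards [eventually_ne_nhds h] with s hs
      rw [lrRatio, Function.update_of_ne hs])

/-- The statistic `n ∑_k (q_k - p_k)² / p_k · h(q_k / p_k)`. -/
def ratioStat {K : ℕ} (h : ℝ → ℝ) (n : ℕ) (q p : Fin K → ℝ) : ℝ :=
  n * ∑ k, (q k - p k) ^ 2 / p k * h (q k / p k)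

theorem pearsonStat_eq_ratioStat {K : ℕ} (n : ℕ) (q p : Fin K → ℝ) :
    pearsonStat n q p = ratioStat (fun _ => 1) n q p := by
  simp [pearsonStat, ratioStat]

-- Each term 2 q log (q / p) is its quadratic part plus 2 (q - p), and these linear parts cancel
-- when both vectors have the same total.
open InformationTheory in
theorem lrStat_eq_ratioStat {K : ℕ} (n : ℕ) (q p : Fin K → ℝ) (hp : ∀ k, 0 < p k)
    (hqp : ∑ k, q k = ∑ k, p k) :
    lrStat n q p = ratioStat lrRatio n q p := by
  have hk : ∀ k, 2 * (q k * Real.log (q k / p k)) =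
      (q k - p k) ^ 2 / p k * lrRatio (q k / p k) + 2 * (q k - p k) := by
    intro k
    have h0 := (hp k).ne'
    have h1 := two_mul_klFun (q k / p k)
    have h2 : (q k - p k) ^ 2 / p k = p k * (q k / p k - 1) ^ 2 := by field_simp
    rw [h2, mul_assoc, ← h1, klFun_apply]
    field_simp
    ring
  have hs : 2 * ∑ k, q k * Real.log (q k / p k) =
      ∑ k, (q k - p k) ^ 2 / p k * lrRatio (q k / p k) := by
    rw [Finset.mul_sum, Finset.sum_congr rfl fun k _ => hk k, Finset.sum_add_distrib,
      ← Finset.mul_sum, Finset.sum_sub_distrib, hqp]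
    ring
  rw [lrStat, ratioStat, ← hs]
  ring

section

variable {N K : ℕ}

theorem sum_weightedProportion (A : Finset (Fin N)) (y : Fin N → Fin K) (w : Fin N → ℝ)
    (hw : ∑ i ∈ A, w i ≠ 0) : ∑ k, weightedProportion A y w k = 1 := by
  simp only [weightedProportion]
  rw [← Finset.sum_div, Finset.sum_fiberwise, div_self hw]

/-- The coordinates on which the bootstrap statistics depend. -/
abbrev BootSpace (K : ℕ) : Type := EuclideanSpace ℝ (Fin K ⊕ Fin K ⊕ Unit)

/-- The contribution of a bootstrap copy of unit `i` to the standardized errors, to the ratios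
`p̂*_k / p̂_k` before normalization, and to the total weight. -/
def bootVec (A : Finset (Fin N)) (y : Fin N → Fin K) (π : Fin N → unitInterval) (i : Fin N) :
    BootSpace K :=
  WithLp.toLp 2 (Sum.elim
    (fun k => √(#A : ℝ) / √(estProportion A y π k) *
      (samplingWeight π i / N * ((if y i = k then 1 else 0) - estProportion A y π k)))
    (Sum.elim (fun k => samplingWeight π i / N * (if y i = k then 1 else 0) / estProportion A y π k)
      (fun _ => samplingWeight π i / N)))

/-- The sum of `bootVec` over the bootstrap sample. -/
def bootSum (A : Finset (Fin N)) (y : Fin N → Fin K) (π : Fin N → unitInterval)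
    (m : Fin N → ℕ) : BootSpace K :=
  ∑ i ∈ A, (m i : ℝ) • bootVec A y π i

/-- `∑_k (R_k / D)² h(u_k / D)` at the point `(R, u, D)`. -/
def ratioMap (h : ℝ → ℝ) (v : BootSpace K) (D : ℝ) : ℝ :=
  ∑ k, (v (Sum.inl k) / D) ^ 2 * h (v (Sum.inr (Sum.inl k)) / D)

theorem bootSum_total (A : Finset (Fin N)) (y : Fin N → Fin K) (π : Fin N → unitInterval)
    (m : Fin N → ℕ) :
    bootSum A y π m (Sum.inr (Sum.inr ())) = (∑ i ∈ A, samplingWeight π i * m i) / N := by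
  simp only [bootSum, WithLp.ofLp_sum, WithLp.ofLp_smul, Finset.sum_apply, Pi.smul_apply, bootVec,
    Sum.elim_inr, smul_eq_mul, Finset.sum_div]
  exact Finset.sum_congr rfl fun i _ => by ring

theorem bootSum_count (A : Finset (Fin N)) (y : Fin N → Fin K) (π : Fin N → unitInterval)
    (m : Fin N → ℕ) (k : Fin K) :
    bootSum A y π m (Sum.inr (Sum.inl k)) =
      (∑ i ∈ A with y i = k, samplingWeight π i * m i) / N / estProportion A y π k := by
  simp only [bootSum, WithLp.ofLp_sum, WithLp.ofLp_smul, Finset.sum_apply, Pi.smul_apply, bootVec,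
    Sum.elim_inr, Sum.elim_inl, smul_eq_mul, Finset.sum_div, Finset.sum_filter]
  refine Finset.sum_congr rfl fun i _ => ?_
  split_ifs <;> ring

theorem bootSum_error (A : Finset (Fin N)) (y : Fin N → Fin K) (π : Fin N → unitInterval)
    (m : Fin N → ℕ) (k : Fin K) :
    bootSum A y π m (Sum.inl k) = √(#A : ℝ) / √(estProportion A y π k) *
      ((∑ i ∈ A with y i = k, samplingWeight π i * m i) / N -
        estProportion A y π k * ((∑ i ∈ A, samplingWeight π i * m i) / N)) := by
  simp only [bootSum, WithLp.ofLp_sum, WithLp.ofLp_smul, Finset.sum_apply, Pi.smul_apply, bootVec,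
    Sum.elim_inl, smul_eq_mul, Finset.sum_div, Finset.sum_filter]
  rw [Finset.mul_sum (a := estProportion A y π k), ← Finset.sum_sub_distrib, Finset.mul_sum]
  refine Finset.sum_congr rfl fun i _ => ?_
  split_ifs <;> ring

/-- The bootstrap proportions are quotients of sums linear in `m`; dividing by the total weight `D`
is the only nonlinearity left besides the fixed map. This is what allows a central limit theorem for
linear sums to be used. -/
theorem ratioStat_bootProportion (h : ℝ → ℝ) (A : Finset (Fin N)) (y : Fin N → Fin K)
    (π : Fin N → unitInterval) (m : Fin N → ℕ) (hp : ∀ k, 0 < estProportion A y π k)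
    (hD : bootSum A y π m (Sum.inr (Sum.inr ())) ≠ 0) :
    ratioStat h #A (bootProportion A y π m) (estProportion A y π) =
      ratioMap h (bootSum A y π m) (bootSum A y π m (Sum.inr (Sum.inr ()))) := by
  rw [bootSum_total] at hD ⊢
  have hN : (N : ℝ) ≠ 0 := fun h0 => hD (by rw [h0, div_zero])
  have hT : ∑ i ∈ A, samplingWeight π i * m i ≠ 0 := fun h0 => hD (by rw [h0, zero_div])
  rw [ratioStat, ratioMap, Finset.mul_sum]
  refine Finset.sum_congr rfl fun k _ => ?_
  rw [bootSum_error, bootSum_count, bootProportion, weightedProportion]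
  have hpk := hp k
  generalize hS : ∑ i ∈ A with y i = k, samplingWeight π i * m i = S
  generalize ∑ i ∈ A, samplingWeight π i * m i = T at *
  generalize estProportion A y π k = p at *
  have hpk' := hpk.ne'
  have h1 : S / N / p / (T / N) = S / T / p := by field_simp
  rw [h1, ← mul_assoc]
  congr 1
  rw [div_pow, mul_pow, div_pow, Real.sq_sqrt (Nat.cast_nonneg _), Real.sq_sqrt hpk.le]
  field_simp

/-- Nonzero total bootstrap weight makes the bootstrap proportions sum to 1; with an empty bootstrap
sample they would all be 0 and the linear terms would not cancel. -/
theorem lrStat_bootProportion (A : Finset (Fin N)) (y : Fin N → Fin K)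
    (π : Fin N → unitInterval) (m : Fin N → ℕ) (hp : ∀ k, 0 < estProportion A y π k)
    (hW : 0 < ∑ i ∈ A, samplingWeight π i)
    (hD : bootSum A y π m (Sum.inr (Sum.inr ())) ≠ 0) :
    lrStat #A (bootProportion A y π m) (estProportion A y π) =
      ratioStat lrRatio #A (bootProportion A y π m) (estProportion A y π) := by
  rw [bootSum_total] at hD
  have hT : ∑ i ∈ A, samplingWeight π i * m i ≠ 0 := fun h0 => hD (by rw [h0, zero_div])
  refine lrStat_eq_ratioStat _ _ _ hp ?_
  rw [bootProportion, estProportion, sum_weightedProportion _ _ _ hT,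
    sum_weightedProportion _ _ _ hW.ne']

end

/-! ### A central limit theorem for the bootstrap sums -/

/-- Since `M z` converges, `z` tends to 0, and log (1 + z) = z + O(|z|²) with M |z|² = |M z| |z| →
0. -/
theorem tendsto_one_add_pow_exp {M : ℕ → ℕ} {z : ℕ → ℂ} {ζ : ℂ} (hM : Tendsto M atTop atTop)
    (hz : Tendsto (fun t => (M t : ℂ) * z t) atTop (𝓝 ζ)) :
    Tendsto (fun t => (1 + z t) ^ M t) atTop (𝓝 (Complex.exp ζ)) := by
  have hM' : Tendsto (fun t => (M t : ℝ)) atTop atTop := tendsto_natCast_atTop_atTop.comp hM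
  have hz0 : Tendsto z atTop (𝓝 0) := by
    rw [tendsto_zero_iff_norm_tendsto_zero]
    have h1 := hz.norm.mul hM'.inv_tendsto_atTop
    rw [mul_zero] at h1
    refine h1.congr' ?_
    filter_upwards [hM'.eventually_gt_atTop 0] with t ht
    simp only [norm_mul, RCLike.norm_natCast, Pi.inv_apply]
    field_simp
  have hlog : Tendsto (fun t => (M t : ℂ) * Complex.log (1 + z t)) atTop (𝓝 ζ) := by
    have hd : Tendsto (fun t => (M t : ℂ) * (Complex.log (1 + z t) - z t)) atTop (𝓝 0) := by
      refine squeeze_zero_norm' (a := fun t => ‖(M t : ℂ) * z t‖ * ‖z t‖) ?_ ?_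
      · have : ∀ᶠ t in atTop, ‖z t‖ < 1 / 2 := by
          have := hz0.norm
          rw [norm_zero] at this
          exact this.eventually (gt_mem_nhds (by norm_num))
        filter_upwards [this] with t ht
        have h1 := Complex.norm_log_one_add_sub_self_le (z := z t) (by linarith)
        have h2 : (1 - ‖z t‖)⁻¹ ≤ 2 := by
          rw [inv_le_comm₀ (by linarith) two_pos]; linarith
        rw [norm_mul, norm_mul, mul_assoc]
        gcongr
        calc _ ≤ ‖z t‖ ^ 2 * (1 - ‖z t‖)⁻¹ / 2 := h1
          _ ≤ ‖z t‖ ^ 2 * 2 / 2 := by gcongr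
          _ = ‖z t‖ * ‖z t‖ := by ring
      · simpa using hz.norm.mul hz0.norm
    have := hz.add hd
    rw [add_zero] at this
    exact this.congr fun t => by ring
  refine ((Complex.continuous_exp.tendsto _).comp hlog).congr' ?_
  have : ∀ᶠ t in atTop, z t ≠ -1 := hz0.eventually_ne (by norm_num)
  filter_upwards [this] with t ht
  have h0 : 1 + z t ≠ 0 := fun h => ht (by linear_combination h)
  rw [Function.comp_apply, Complex.exp_nat_mul, Complex.exp_log h0]

theorem norm_exp_mul_I_sub_le {x : ℝ} (hx : |x| ≤ 1) :
    ‖Complex.exp (x * Complex.I) - 1 - (x * Complex.I - x ^ 2 / 2)‖ ≤ |x| ^ 3 := by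
  have hn : ‖(x : ℂ) * Complex.I‖ = |x| := by simp
  have h := Complex.exp_bound (x := (x : ℂ) * Complex.I) (by rw [hn]; exact hx)
    (n := 3) (by norm_num)
  rw [hn] at h
  have hs : ∑ m ∈ Finset.range 3, ((x : ℂ) * Complex.I) ^ m / (m.factorial : ℂ) =
      1 + (x * Complex.I - x ^ 2 / 2) := by
    simp only [Finset.sum_range_succ, Finset.sum_range_zero, Nat.factorial]
    have := Complex.I_sq
    push_cast
    linear_combination (x : ℂ) ^ 2 / 2 * this
  rw [hs, ← sub_sub] at h
  refine h.trans ?_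
  have : (((Nat.succ 3 : ℕ) : ℝ) * (((Nat.factorial 3 : ℕ) : ℝ) * ((3 : ℕ) : ℝ))⁻¹) ≤ 1 := by
    norm_num [Nat.factorial]
  exact mul_le_of_le_one_right (by positivity) this

section

variable {N : ℕ → ℕ} {A : ∀ t, Finset (Fin (N t))} {π : ∀ t, Fin (N t) → unitInterval}

theorem integral_exp_bootstrapLaw {N : ℕ} (A : Finset (Fin N)) (π : Fin N → unitInterval)
    (hW : 0 < ∑ i ∈ A, samplingWeight π i) (hπ : ∀ i ∈ A, 0 < (π i : ℝ)) (x : Fin N → ℝ) :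
    ∫ m, Complex.exp ((∑ i ∈ A, (m i : ℝ) * x i : ℝ) * Complex.I) ∂(bootstrapLaw A π) =
      (1 + (∑ i ∈ A, (Complex.exp (x i * Complex.I) - 1)) /
        ((∑ i ∈ A, samplingWeight π i : ℝ) : ℂ)) ^ N := by
  have h := integral_prod_pow_bootstrapLaw A π hW hπ
    -- The generating function runs over all units; the value 1 off `A` removes the factors of
    -- unsampled units.
    (fun i => if i ∈ A then Complex.exp (x i * Complex.I) else 1) (fun i => by
      split_ifs
      · rw [Complex.norm_exp_ofReal_mul_I]
      · simp)
  rw [Finset.sum_congr rfl fun i hi => by rw [if_pos hi]] at h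
  rw [← h]
  congr 1
  ext m
  simp_rw [ite_pow, one_pow]
  rw [Finset.prod_ite_mem, Finset.univ_inter, Complex.ofReal_sum, Finset.sum_mul, Complex.exp_sum]
  refine Finset.prod_congr rfl fun i _ => ?_
  rw [← Complex.exp_nat_mul]
  congr 1
  push_cast
  ring

/-- Expand e^{ix} - 1 = ix - x² / 2 + O(|x|³). The cubic remainder is at most `b t` times the second
moment sum, hence negligible. Uncentered second moments suffice: a single trial has mean of order 1
/ N, whose square contributes nothing over N trials. -/
theorem tendsto_integral_exp_bootstrapLaw (hN : Tendsto N atTop atTop)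
    (hW : ∀ t, 0 < ∑ i ∈ A t, samplingWeight (π t) i) (hπ : ∀ t, ∀ i ∈ A t, 0 < (π t i : ℝ))
    (x : ∀ t, Fin (N t) → ℝ) (b : ℕ → ℝ) (hb : Tendsto b atTop (𝓝 0))
    (hxb : ∀ t, ∀ i ∈ A t, |x t i| ≤ b t) (μ q : ℝ)
    (hμ : Tendsto (fun t => N t / (∑ i ∈ A t, samplingWeight (π t) i) * ∑ i ∈ A t, x t i)
      atTop (𝓝 μ))
    (hq : Tendsto (fun t => N t / (∑ i ∈ A t, samplingWeight (π t) i) * ∑ i ∈ A t, x t i ^ 2)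
      atTop (𝓝 q)) :
    Tendsto (fun t => ∫ m, Complex.exp ((∑ i ∈ A t, (m i : ℝ) * x t i : ℝ) * Complex.I)
      ∂(bootstrapLaw (A t) (π t))) atTop (𝓝 (Complex.exp (μ * Complex.I - q / 2))) := by
  simp_rw [fun t => integral_exp_bootstrapLaw (A t) (π t) (hW t) (hπ t) (x t)]
  refine tendsto_one_add_pow_exp hN ?_
  set r : ℕ → ℝ := fun t => N t / (∑ i ∈ A t, samplingWeight (π t) i) with hr
  have hr0 : ∀ t, 0 ≤ r t := fun t => div_nonneg (Nat.cast_nonneg _) (hW t).le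
  have hmain : Tendsto (fun t => ((r t * ∑ i ∈ A t, x t i : ℝ) : ℂ) * Complex.I -
      ((r t * ∑ i ∈ A t, x t i ^ 2 : ℝ) : ℂ) / 2) atTop (𝓝 (μ * Complex.I - q / 2)) :=
    (((Complex.continuous_ofReal.tendsto _).comp hμ).mul_const _).sub
      (((Complex.continuous_ofReal.tendsto _).comp hq).div_const _)
  have hrem : Tendsto (fun t => (r t : ℂ) * ∑ i ∈ A t, (Complex.exp (x t i * Complex.I) - 1 -
      (x t i * Complex.I - x t i ^ 2 / 2))) atTop (𝓝 0) := by
    refine squeeze_zero_norm' (a := fun t => b t * (r t * ∑ i ∈ A t, x t i ^ 2)) ?_ ?_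
    · filter_upwards [hb.eventually (gt_mem_nhds one_pos)] with t ht
      rw [norm_mul, Complex.norm_real, Real.norm_of_nonneg (hr0 t), mul_left_comm]
      gcongr
      · exact hr0 t
      refine (norm_sum_le _ _).trans ?_
      rw [Finset.mul_sum]
      refine Finset.sum_le_sum fun i hi => ?_
      refine (norm_exp_mul_I_sub_le ((hxb t i hi).trans ht.le)).trans ?_
      rw [pow_succ', sq_abs]
      exact mul_le_mul_of_nonneg_right (hxb t i hi) (sq_nonneg _)
    · simpa using hb.mul hq
  have := hmain.add hrem
  rw [add_zero] at this
  refine this.congr fun t => ?_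
  have e1 : ((N t : ℂ) * ((∑ i ∈ A t, (Complex.exp (x t i * Complex.I) - 1)) /
      ((∑ i ∈ A t, samplingWeight (π t) i : ℝ) : ℂ))) =
      (r t : ℂ) * ∑ i ∈ A t, (Complex.exp (x t i * Complex.I) - 1) := by
    simp only [hr]
    rw [Complex.ofReal_div, Complex.ofReal_natCast]
    ring
  rw [e1, Finset.sum_sub_distrib (f := fun i => Complex.exp (x t i * Complex.I) - 1),
    Finset.sum_sub_distrib (f := fun i => (x t i : ℂ) * Complex.I), ← Finset.sum_mul,
    ← Finset.sum_div]
  push_cast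
  ring

/-- If the summands are uniformly small and their first and second moments converge, the law of
the bootstrap sum converges weakly to the law with the limiting characteristic function. -/
theorem tendsto_integral_bootstrap_sum {J : Type*} [Fintype J] (hN : Tendsto N atTop atTop)
    (hW : ∀ t, 0 < ∑ i ∈ A t, samplingWeight (π t) i) (hπ : ∀ t, ∀ i ∈ A t, 0 < (π t i : ℝ))
    (v : ∀ t, Fin (N t) → EuclideanSpace ℝ J) (b : ℕ → ℝ) (hb : Tendsto b atTop (𝓝 0))
    (hvb : ∀ t, ∀ i ∈ A t, ∀ j, |v t i j| ≤ b t) (μ : J → ℝ) (M : J → J → ℝ)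
    (hμ : ∀ j, Tendsto (fun t => N t / (∑ i ∈ A t, samplingWeight (π t) i) *
      ∑ i ∈ A t, v t i j) atTop (𝓝 (μ j)))
    (hM : ∀ j k, Tendsto (fun t => N t / (∑ i ∈ A t, samplingWeight (π t) i) *
      ∑ i ∈ A t, v t i j * v t i k) atTop (𝓝 (M j k)))
    (ν : Measure (EuclideanSpace ℝ J)) [IsProbabilityMeasure ν]
    (hν : ∀ u, charFun ν u = Complex.exp ((∑ j, u j * μ j : ℝ) * Complex.I -
      (∑ j, ∑ k, u j * u k * M j k : ℝ) / 2))
    (F : BoundedContinuousFunction (EuclideanSpace ℝ J) ℝ) :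
    Tendsto (fun t => ∫ m, F (∑ i ∈ A t, (m i : ℝ) • v t i) ∂(bootstrapLaw (A t) (π t))) atTop
      (𝓝 (∫ z, F z ∂ν)) := by
  have hprob : ∀ t, IsProbabilityMeasure (bootstrapLaw (A t) (π t)) :=
    fun t => isProbabilityMeasure_bootstrapLaw (A t) (π t) (hW t)
  let V : ∀ t, (Fin (N t) → ℕ) → EuclideanSpace ℝ J := fun t m => ∑ i ∈ A t, (m i : ℝ) • v t i
  have hV : ∀ t, Measurable (V t) := fun t => Measurable.of_discrete
  let ρ : ℕ → ProbabilityMeasure (EuclideanSpace ℝ J) := fun t =>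
    ⟨(bootstrapLaw (A t) (π t)).map (V t), Measure.isProbabilityMeasure_map (hV t).aemeasurable⟩
  let ν' : ProbabilityMeasure (EuclideanSpace ℝ J) := ⟨ν, inferInstance⟩
  have hlim : Tendsto ρ atTop (𝓝 ν') := by
    refine ProbabilityMeasure.tendsto_of_tendsto_charFun fun u => ?_
    change Tendsto (fun t => charFun ((bootstrapLaw (A t) (π t)).map (V t)) u) atTop
      (𝓝 (charFun ν u))
    rw [hν]
    -- The characteristic function at `u` is a scalar problem for the projections of `v t i` on `u`;
    -- these are bounded by ∑ |u_j| times `b t`.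
    have key := tendsto_integral_exp_bootstrapLaw hN hW hπ (fun t i => ∑ j, u j * v t i j)
      (fun t => (∑ j, |u j|) * b t) (by simpa using hb.const_mul (∑ j, |u j|)) (fun t i hi => by
        rw [Finset.sum_mul]
        refine (Finset.abs_sum_le_sum_abs _ _).trans (Finset.sum_le_sum fun j _ => ?_)
        rw [abs_mul]
        exact mul_le_mul_of_nonneg_left (hvb t i hi j) (abs_nonneg _))
      (∑ j, u j * μ j) (∑ j, ∑ k, u j * u k * M j k) ?_ ?_
    · refine key.congr fun t => ?_
      rw [charFun_apply, integral_map (hV t).aemeasurable (by fun_prop)]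
      congr 1
      ext m
      congr 3
      rw [sum_inner]
      refine Finset.sum_congr rfl fun i _ => ?_
      rw [real_inner_smul_left]
      simp only [PiLp.inner_apply, RCLike.inner_apply, conj_trivial]
    · have := tendsto_finsetSum Finset.univ fun j _ => (hμ j).const_mul (u j)
      refine this.congr fun t => ?_
      rw [Finset.sum_comm, Finset.mul_sum]
      refine Finset.sum_congr rfl fun j _ => ?_
      rw [← Finset.mul_sum]
      ring
    · have := tendsto_finsetSum Finset.univ fun j _ => tendsto_finsetSum Finset.univ
        fun k _ => (hM j k).const_mul (u j * u k)
      refine this.congr fun t => ?_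
      have hsq : ∀ i, (∑ j, u j * v t i j) ^ 2 =
          ∑ j, ∑ k, u j * u k * (v t i j * v t i k) := by
        intro i
        rw [sq, Finset.sum_mul_sum]
        refine Finset.sum_congr rfl fun j _ => Finset.sum_congr rfl fun k _ => by ring
      simp_rw [hsq]
      rw [Finset.sum_comm (s := A t), Finset.mul_sum]
      refine Finset.sum_congr rfl fun j _ => ?_
      rw [Finset.sum_comm (s := A t), Finset.mul_sum]
      refine Finset.sum_congr rfl fun k _ => ?_
      rw [← Finset.mul_sum]
      ring
  rw [ProbabilityMeasure.tendsto_iff_forall_integral_tendsto] at hlim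
  refine (hlim F).congr fun t => ?_
  change ∫ z, F z ∂((bootstrapLaw (A t) (π t)).map (V t)) = _
  rw [integral_map (hV t).aemeasurable F.continuous.aestronglyMeasurable]

end

/-! ### Linear algebra of the design-effect matrix -/

open Matrix in
/-- A real symmetric matrix is diagonalized by an orthogonal matrix, with the eigenvalues in
increasing order. -/
theorem exists_orthogonal_diagonalization {d : ℕ} (C : Matrix (Fin d) (Fin d) ℝ) (hC : Cᵀ = C) :
    ∃ (U : Matrix (Fin d) (Fin d) ℝ) (l : Fin d → ℝ), Monotone l ∧ Uᵀ * U = 1 ∧ U * Uᵀ = 1 ∧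
      Uᵀ * C * U = diagonal l := by
  have hH : C.IsHermitian := by rw [IsHermitian, conjTranspose_eq_transpose_of_trivial, hC]
  set V : Matrix (Fin d) (Fin d) ℝ := hH.eigenvectorUnitary.1 with hV
  have hV1 : Vᵀ * V = 1 := by
    have := Unitary.coe_star_mul_self hH.eigenvectorUnitary
    rwa [star_eq_conjTranspose, conjTranspose_eq_transpose_of_trivial] at this
  have hVC : Vᵀ * C * V = diagonal hH.eigenvalues := by
    have := hH.conjStarAlgAut_star_eigenvectorUnitary
    rw [Unitary.conjStarAlgAut_star_apply, star_eq_conjTranspose,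
      conjTranspose_eq_transpose_of_trivial] at this
    exact this
  -- Permuting the eigenvectors by `σ` puts the eigenvalues in increasing order.
  let σ := Tuple.sort hH.eigenvalues
  let R : Matrix (Fin d) (Fin d) ℝ := (1 : Matrix (Fin d) (Fin d) ℝ).submatrix id σ
  have hU : V.submatrix id σ = V * R := by
    ext i j
    simp [R, mul_apply, one_apply]
  refine ⟨V.submatrix id σ, hH.eigenvalues ∘ σ, Tuple.monotone_sort _, ?_, ?_, ?_⟩
  · rw [transpose_submatrix, submatrix_mul _ _ _ id _ Function.bijective_id |>.symm, hV1]
    simp [submatrix_one_equiv]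
  · rw [transpose_submatrix, submatrix_mul _ _ _ σ _ σ.bijective |>.symm,
      mul_eq_one_comm.1 hV1, submatrix_id_id]
  · have : (V.submatrix id σ)ᵀ * C * V.submatrix id σ = (Vᵀ * C * V).submatrix σ σ := by
      rw [transpose_submatrix, submatrix_mul _ _ _ id _ Function.bijective_id,
        submatrix_mul _ _ _ id _ Function.bijective_id, submatrix_id_id]
    rw [this, hVC]
    simp [submatrix_diagonal_equiv]

open Matrix in
theorem charpoly_eq_of_diagonalization {d : ℕ} {C U : Matrix (Fin d) (Fin d) ℝ} {l : Fin d → ℝ}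
    (hU : U * Uᵀ = 1) (h : Uᵀ * C * U = diagonal l) :
    C.charpoly = ∏ k, (Polynomial.X - Polynomial.C (l k)) := by
  have : (Uᵀ * C * U).charpoly = C.charpoly := by
    rw [charpoly_mul_comm, ← mul_assoc, hU, one_mul]
  rw [← this, h, charpoly_diagonal]

-- The eigenvalue `l k` is the quadratic form at the k-th column of `U`, so it is nonnegative and
-- has a square root.
open Matrix in
theorem exists_eq_mul_transpose {d : ℕ} (S : Matrix (Fin d) (Fin d) ℝ) (hS : Sᵀ = S)
    (hpos : ∀ u : Fin d → ℝ, 0 ≤ ∑ k, ∑ l, u k * u l * S k l) :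
    ∃ H : Matrix (Fin d) (Fin d) ℝ, S = H * Hᵀ := by
  obtain ⟨U, l, -, -, hU, hd⟩ := exists_orthogonal_diagonalization S hS
  have hl : ∀ k, 0 ≤ l k := by
    intro k
    have h1 : (Uᵀ * S * U) k k = l k := by rw [hd, diagonal_apply_eq]
    rw [← h1]
    convert hpos fun i => U i k using 1
    simp only [mul_apply, transpose_apply, Finset.sum_mul]
    rw [Finset.sum_comm]
    exact Finset.sum_congr rfl fun i _ => Finset.sum_congr rfl fun j _ => by ring
  refine ⟨U * diagonal fun k => √(l k), ?_⟩
  have h2 : U * (Uᵀ * S * U) * Uᵀ = S := by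
    rw [show U * (Uᵀ * S * U) * Uᵀ = (U * Uᵀ) * S * (U * Uᵀ) by simp only [Matrix.mul_assoc], hU,
      Matrix.one_mul, Matrix.mul_one]
  rw [transpose_mul, diagonal_transpose, Matrix.mul_assoc, ← Matrix.mul_assoc (diagonal _),
    diagonal_mul_diagonal, ← Matrix.mul_assoc]
  simp_rw [Real.mul_self_sqrt (hl _)]
  rw [← hd, h2]

/-- The coordinates in `ℝ^(d+1)` of a vector with sum zero given by its first `d` coordinates. -/
def zeroSumExt (d : ℕ) : Matrix (Fin (d + 1)) (Fin d) ℝ :=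
  fun k j => (if k = j.castSucc then 1 else 0) - (if k = Fin.last d then 1 else 0)

theorem sum_zeroSumExt_mul {d : ℕ} (x : Fin (d + 1) → ℝ) (hx : ∑ k, x k = 0) (k : Fin (d + 1)) :
    ∑ j, zeroSumExt d k j * x j.castSucc = x k := by
  induction k using Fin.lastCases with
  | last =>
    rw [Fin.sum_univ_castSucc] at hx
    have : ∀ j : Fin d, Fin.last d ≠ j.castSucc := fun j => (Fin.castSucc_lt_last j).ne'
    simp only [zeroSumExt, this, if_false, if_true, zero_sub, neg_one_mul, Finset.sum_neg_distrib]
    linarith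
  | cast k =>
    have : k.castSucc ≠ Fin.last d := (Fin.castSucc_lt_last k).ne
    simp [zeroSumExt, this, Fin.castSucc_inj]

/-- `zeroSumExt` with the coordinates divided by `√p_k`. -/
def scaledExt {d : ℕ} (p : Fin (d + 1) → ℝ) : Matrix (Fin (d + 1)) (Fin d) ℝ :=
  fun k j => zeroSumExt d k j / √(p k)

-- The sum of x_k² / p_k over all d + 1 coordinates of a zero-sum vector is thus the quadratic form
-- of P₀⁻¹ in the first d of them. Both sides have entries δ_ij / p_i + 1 / p_last, the
-- Sherman–Morrison inverse of diag(p) - ppᵀ.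
open Matrix in
theorem scaledExt_transpose_mul_self {d : ℕ} (p : Fin (d + 1) → ℝ) (hp : ∀ k, 0 < p k)
    (hsum : ∑ k, p k = 1) : (scaledExt p)ᵀ * scaledExt p = (multinomialCov p)⁻¹ := by
  have hentry : ∀ i j, ((scaledExt p)ᵀ * scaledExt p) i j =
      (if i = j then (p i.castSucc)⁻¹ else 0) + (p (Fin.last d))⁻¹ := by
    intro i j
    have hne : ∀ j : Fin d, Fin.last d ≠ j.castSucc := fun j => (Fin.castSucc_lt_last j).ne'
    have hne' : ∀ j : Fin d, j.castSucc ≠ Fin.last d := fun j => (Fin.castSucc_lt_last j).ne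
    have hsq : ∀ k, √(p k) * √(p k) = p k := fun k => Real.mul_self_sqrt (hp k).le
    rw [mul_apply, Fin.sum_univ_castSucc]
    simp only [transpose_apply, scaledExt, zeroSumExt, hne, hne', if_true, if_false, sub_zero,
      zero_sub, div_mul_div_comm, hsq, Fin.castSucc_inj]
    simp [ite_div]
    by_cases h : i = j
    · simp [h]
    · simp [h, eq_comm]
  rw [eq_comm]
  refine inv_eq_right_inv ?_
  ext i j
  have hs : ∑ k : Fin d, p k.castSucc = 1 - p (Fin.last d) := by
    rw [Fin.sum_univ_castSucc] at hsum
    linarith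
  have hpi := (hp i.castSucc).ne'
  have hpj := (hp j.castSucc).ne'
  have hpl := (hp (Fin.last d)).ne'
  have hterm : ∀ k, multinomialCov p i k * ((scaledExt p)ᵀ * scaledExt p) k j =
      (if i = k then p i.castSucc * ((if k = j then (p k.castSucc)⁻¹ else 0) +
        (p (Fin.last d))⁻¹) else 0) -
      p i.castSucc * ((if k = j then 1 else 0) + p k.castSucc * (p (Fin.last d))⁻¹) := by
    intro k
    rw [hentry, multinomialCov, Matrix.sub_apply, diagonal_apply, vecMulVec_apply]
    have := (hp k.castSucc).ne'
    split_ifs <;> field_simp <;> ring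
  rw [mul_apply, Finset.sum_congr rfl fun k _ => hterm k, Finset.sum_sub_distrib,
    Finset.sum_ite_eq, ← Finset.mul_sum, Finset.sum_add_distrib, ← Finset.sum_mul, hs,
    Finset.sum_ite_eq', one_apply]
  simp only [Finset.mem_univ, if_true]
  split_ifs with h
  · subst h; field_simp; ring
  · field_simp; ring

open Matrix in
/-- The eigenvalues of the design-effect matrix, and a square root of the limiting covariance
matrix of the standardized errors whose Gram matrix they diagonalize. -/
theorem exists_designEffect_eigenvalues {d : ℕ} (p : Fin (d + 1) → ℝ) (hp : ∀ k, 0 < p k)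
    (hsum : ∑ k, p k = 1) (S : Matrix (Fin d) (Fin d) ℝ) (hS : Sᵀ = S)
    (hpos : ∀ u : Fin d → ℝ, 0 ≤ ∑ k, ∑ l, u k * u l * S k l) :
    ∃ l : Fin d → ℝ, Monotone l ∧
      ((multinomialCov p)⁻¹ * S).charpoly = ∏ k, (Polynomial.X - Polynomial.C (l k)) ∧
      ∃ G : Matrix (Fin (d + 1)) (Fin d) ℝ,
        G * Gᵀ = scaledExt p * S * (scaledExt p)ᵀ ∧ Gᵀ * G = diagonal l := by
  obtain ⟨H, rfl⟩ := exists_eq_mul_transpose S hS hpos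
  set F := scaledExt p
  -- P₀⁻¹S = FᵀFHHᵀ need not be symmetric. Moving `Hᵀ` to the front keeps the characteristic
  -- polynomial and gives a symmetric matrix.
  obtain ⟨U, l, hl, -, hU, hd⟩ := exists_orthogonal_diagonalization (Hᵀ * (Fᵀ * F) * H)
    (by simp only [transpose_mul, transpose_transpose, Matrix.mul_assoc])
  refine ⟨l, hl, ?_, F * H * U, ?_, ?_⟩
  · rw [← charpoly_eq_of_diagonalization hU hd, ← scaledExt_transpose_mul_self p hp hsum,
      ← mul_assoc, charpoly_mul_comm, ← mul_assoc]
  · rw [transpose_mul, Matrix.mul_assoc, ← Matrix.mul_assoc U, hU, Matrix.one_mul, transpose_mul]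
    simp only [Matrix.mul_assoc]
  · rw [← hd]
    simp only [transpose_mul, Matrix.mul_assoc]

/-! ### The limit law -/

open Matrix in
/-- The point `(G z, 1, 1)`. -/
def limitPoint {d K : ℕ} (G : Matrix (Fin K) (Fin d) ℝ) (z : Fin d → ℝ) : BootSpace K :=
  WithLp.toLp 2 (Sum.elim (G *ᵥ z) fun _ => 1)

theorem continuous_limitPoint {d K : ℕ} (G : Matrix (Fin K) (Fin d) ℝ) :
    Continuous (limitPoint G) := by
  refine (PiLp.continuous_toLp 2 _).comp (continuous_pi fun j => ?_)
  rcases j with k | j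
  · exact (continuous_apply k).comp (Continuous.matrix_mulVec continuous_const continuous_id)
  · exact continuous_const

/-- The law of `(G Z, 1, 1)` with `Z` standard normal. -/
def limitLaw {d K : ℕ} (G : Matrix (Fin K) (Fin d) ℝ) : Measure (BootSpace K) :=
  (Measure.pi fun _ : Fin d => gaussianReal 0 1).map (limitPoint G)

instance {d K : ℕ} (G : Matrix (Fin K) (Fin d) ℝ) : IsProbabilityMeasure (limitLaw G) :=
  Measure.isProbabilityMeasure_map (continuous_limitPoint G).measurable.aemeasurable

/-- The mean of the limit law. -/
def limitMean (K : ℕ) : Fin K ⊕ Fin K ⊕ Unit → ℝ := Sum.elim (fun _ => 0) fun _ => 1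

/-- The covariance of the limit law. -/
def limitCov {K : ℕ} (S : Matrix (Fin K) (Fin K) ℝ) (j k : Fin K ⊕ Fin K ⊕ Unit) : ℝ :=
  Sum.elim (fun a => Sum.elim (fun b => S a b) (fun _ => 0) k) (fun _ => 0) j

-- The exponent is the constant part plus a linear form in independent normals, so the integral
-- factors; the variance of the linear form is the quadratic form of GGᵀ.
open Matrix in
theorem charFun_limitLaw {d K : ℕ} (G : Matrix (Fin K) (Fin d) ℝ) (u : BootSpace K) :
    charFun (limitLaw G) u = Complex.exp ((∑ j, u j * limitMean K j : ℝ) * Complex.I -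
      (∑ j, ∑ k, u j * u k * limitCov (G * Gᵀ) j k : ℝ) / 2) := by
  have hmeas := (continuous_limitPoint G).measurable
  rw [charFun_apply, limitLaw, integral_map hmeas.aemeasurable (by fun_prop)]
  have hexp : ∀ z : Fin d → ℝ, Complex.exp (inner ℝ (limitPoint G z) u * Complex.I) =
      Complex.exp ((∑ j, u j * limitMean K j : ℝ) * Complex.I) *
      ∏ j, Complex.exp (((∑ k, u (Sum.inl k) * G k j : ℝ) : ℂ) * z j * Complex.I) := by
    intro z
    rw [← Complex.exp_sum, ← Complex.exp_add, ← Finset.sum_mul, ← add_mul]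
    have hreal : inner ℝ (limitPoint G z) u = ∑ j, u j * limitMean K j +
        ∑ j, (∑ k, u (Sum.inl k) * G k j) * z j := by
      rw [Finset.sum_congr rfl fun j _ => Finset.sum_mul _ _ _, Finset.sum_comm]
      simp only [PiLp.inner_apply, RCLike.inner_apply, conj_trivial, limitPoint, limitMean,
        Fintype.sum_sum_type, Sum.elim_inl, Sum.elim_inr, mulVec, dotProduct, mul_zero, mul_one,
        Finset.sum_const_zero, zero_add, Finset.mul_sum, mul_assoc]
      rw [add_comm]
    rw [hreal]
    push_cast
    rfl
  simp_rw [hexp]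
  rw [integral_const_mul, integral_fintype_prod_eq_prod
    (f := fun j (x : ℝ) => Complex.exp (((∑ k, u (Sum.inl k) * G k j : ℝ) : ℂ) * x * Complex.I))]
  simp_rw [← charFun_apply_real, charFun_gaussianReal]
  rw [← Complex.exp_sum, ← Complex.exp_add]
  congr 1
  have hq : ∑ j, ∑ k, u j * u k * limitCov (G * Gᵀ) j k =
      ∑ i, (∑ k, u (Sum.inl k) * G k i) ^ 2 := by
    simp only [Fintype.sum_sum_type, limitCov, Sum.elim_inl, Sum.elim_inr, mul_zero,
      Finset.sum_const_zero, add_zero, mul_apply, transpose_apply, sq, Finset.sum_mul_sum]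
    rw [Finset.sum_comm (s := univ (α := Fin d))]
    refine Finset.sum_congr rfl fun a _ => ?_
    rw [Finset.sum_comm (s := univ (α := Fin d))]
    refine Finset.sum_congr rfl fun b _ => ?_
    rw [Finset.mul_sum]
    exact Finset.sum_congr rfl fun i _ => by ring
  rw [hq]
  push_cast
  simp [Finset.sum_div, sub_eq_add_neg, Finset.sum_neg_distrib]

-- This is |Gz|² = zᵀ(GᵀG)z; the factor `h` is evaluated only at 1.
open Matrix in
theorem ratioMap_limitPoint {d K : ℕ} (G : Matrix (Fin K) (Fin d) ℝ) (l : Fin d → ℝ)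
    (hG : Gᵀ * G = diagonal l) (h : ℝ → ℝ) (h1 : h 1 = 1)
    (z : Fin d → ℝ) : ratioMap h (limitPoint G z) 1 = ∑ k, l k * z k ^ 2 := by
  have h2 : (G *ᵥ z) ⬝ᵥ (G *ᵥ z) = z ⬝ᵥ (diagonal l *ᵥ z) := by
    rw [← hG, dotProduct_mulVec, ← mulVec_mulVec, dotProduct_mulVec, vecMul_transpose,
      dotProduct_mulVec]
  simp only [dotProduct, mulVec_diagonal] at h2
  simp only [ratioMap, limitPoint, Sum.elim_inl, Sum.elim_inr, div_one, h1, mul_one, sq]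
  rw [h2]
  exact Finset.sum_congr rfl fun k _ => by ring

/-! ### Moments of the summands for a given sample -/

section

variable {N K : ℕ} {A : Finset (Fin N)} {y : Fin N → Fin K} {π : Fin N → unitInterval}

theorem estProportion_nonneg (k : Fin K) : 0 ≤ estProportion A y π k :=
  div_nonneg (Finset.sum_nonneg fun i _ => samplingWeight_nonneg π i)
    (Finset.sum_nonneg fun i _ => samplingWeight_nonneg π i)

theorem estProportion_le_one (k : Fin K) : estProportion A y π k ≤ 1 :=
  div_le_one_of_le₀ (Finset.sum_le_sum_of_subset_of_nonneg (Finset.filter_subset _ _)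
    fun i _ _ => samplingWeight_nonneg π i) (Finset.sum_nonneg fun i _ => samplingWeight_nonneg π i)

theorem abs_indicator_sub_le {q : ℝ} (h0 : 0 ≤ q) (h1 : q ≤ 1) (P : Prop) [Decidable P] :
    |(if P then 1 else 0) - q| ≤ 1 := by
  rw [abs_le]; split_ifs <;> constructor <;> linarith

/-- p̂_k is the w-weighted mean of the indicators over `A`, so the bootstrap errors are centered
exactly. -/
theorem sum_bootVec_error (hW : 0 < ∑ i ∈ A, samplingWeight π i) (k : Fin K) :
    ∑ i ∈ A, bootVec A y π i (Sum.inl k) = 0 := by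
  have h : ∑ i ∈ A, samplingWeight π i * ((if y i = k then 1 else 0) - estProportion A y π k) =
      0 := by
    simp_rw [mul_sub, mul_ite, mul_one, mul_zero]
    rw [Finset.sum_sub_distrib, ← Finset.sum_filter, ← Finset.sum_mul, estProportion,
      weightedProportion, mul_div_cancel₀ _ hW.ne', sub_self]
  simp only [bootVec, Sum.elim_inl]
  rw [← Finset.mul_sum, Finset.sum_congr rfl fun i _ => div_mul_eq_mul_div _ _ _,
    ← Finset.sum_div, h, zero_div, mul_zero]

theorem mean_bootVec_inr (hN : N ≠ 0) (hW : 0 < ∑ i ∈ A, samplingWeight π i)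
    (hp : ∀ k, 0 < estProportion A y π k) (j : Fin K ⊕ Unit) :
    N / (∑ i ∈ A, samplingWeight π i) * ∑ i ∈ A, bootVec A y π i (Sum.inr j) = 1 := by
  have hN' : (N : ℝ) ≠ 0 := Nat.cast_ne_zero.2 hN
  rcases j with k | j
  · simp only [bootVec, Sum.elim_inr, Sum.elim_inl]
    have hk := hp k
    have hS : ∑ i ∈ A, samplingWeight π i / N * (if y i = k then 1 else 0) / estProportion A y π k =
        (∑ i ∈ A with y i = k, samplingWeight π i) / N / estProportion A y π k := by
      rw [Finset.sum_filter, Finset.sum_div, Finset.sum_div]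
      exact Finset.sum_congr rfl fun i _ => by split_ifs <;> ring
    rw [hS]
    have h0 : ∑ i ∈ A with y i = k, samplingWeight π i ≠ 0 := by
      intro h0
      rw [estProportion, weightedProportion, h0, zero_div] at hk
      exact hk.false
    rw [estProportion, weightedProportion]
    field_simp
  · simp only [bootVec, Sum.elim_inr]
    rw [← Finset.sum_div]
    field_simp

theorem bootVec_inr_nonneg (i : Fin N) (j : Fin K ⊕ Unit) : 0 ≤ bootVec A y π i (Sum.inr j) := by
  have := samplingWeight_nonneg π i
  rcases j with k | j
  · have h2 := estProportion_nonneg (A := A) (y := y) (π := π) k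
    simp only [bootVec, Sum.elim_inr, Sum.elim_inl]
    positivity
  · simp only [bootVec, Sum.elim_inr]
    positivity

/-- A bound for the coordinates of `bootVec`, in terms of a bound for `w_i / N`. -/
def bootBound (A : Finset (Fin N)) (y : Fin N → Fin K) (π : Fin N → unitInterval) (c : ℝ) : ℝ :=
  ∑ k, √(#A : ℝ) / √(estProportion A y π k) * c + ∑ k, c / estProportion A y π k + c

theorem abs_bootVec_le {c : ℝ} {i : Fin N} (hc : samplingWeight π i / N ≤ c)
    (j : Fin K ⊕ Fin K ⊕ Unit) : |bootVec A y π i j| ≤ bootBound A y π c := by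
  have hp := estProportion_nonneg (A := A) (y := y) (π := π)
  have hw : 0 ≤ samplingWeight π i / N := div_nonneg (samplingWeight_nonneg π i) (Nat.cast_nonneg _)
  have hc0 : 0 ≤ c := hw.trans hc
  have h1 : ∀ k, 0 ≤ √(#A : ℝ) / √(estProportion A y π k) * c := fun k => by positivity
  have h2 : ∀ k, 0 ≤ c / estProportion A y π k := fun k => div_nonneg hc0 (hp k)
  have s1 := Finset.sum_nonneg fun k (_ : k ∈ univ) => h1 k
  have s2 := Finset.sum_nonneg fun k (_ : k ∈ univ) => h2 k
  rw [bootBound]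
  rcases j with k | k | j
  · have : |bootVec A y π i (Sum.inl k)| ≤ √(#A : ℝ) / √(estProportion A y π k) * c := by
      simp only [bootVec, Sum.elim_inl]
      rw [abs_mul, abs_mul, abs_of_nonneg hw, abs_of_nonneg (by positivity)]
      gcongr
      calc _ ≤ samplingWeight π i / N * 1 := by
            gcongr
            exact abs_indicator_sub_le (hp k) (estProportion_le_one k) _
        _ ≤ c := by rwa [mul_one]
    have := this.trans (Finset.single_le_sum (fun k _ => h1 k) (Finset.mem_univ k))
    linarith
  · have : |bootVec A y π i (Sum.inr (Sum.inl k))| ≤ c / estProportion A y π k := by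
      rw [abs_of_nonneg (bootVec_inr_nonneg i _)]
      simp only [bootVec, Sum.elim_inl, Sum.elim_inr]
      gcongr
      · exact hp k
      · split_ifs
        · rwa [mul_one]
        · rwa [mul_zero]
    have := this.trans (Finset.single_le_sum (fun k _ => h2 k) (Finset.mem_univ k))
    linarith
  · rw [abs_of_nonneg (bootVec_inr_nonneg i _)]
    simp only [bootVec, Sum.elim_inr]
    linarith

/-- The ratio and total-weight coordinates are nonnegative with normalized sum 1, so a second moment
involving one of them is at most the uniform bound. Hence these coordinates are constant in the
limit and uncorrelated with the errors. -/
theorem abs_moment_bootVec_le {c : ℝ} (hN : N ≠ 0) (hW : 0 < ∑ i ∈ A, samplingWeight π i)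
    (hp : ∀ k, 0 < estProportion A y π k) (hc : ∀ i ∈ A, samplingWeight π i / N ≤ c)
    (j : Fin K ⊕ Fin K ⊕ Unit) (k : Fin K ⊕ Unit) :
    |N / (∑ i ∈ A, samplingWeight π i) *
      ∑ i ∈ A, bootVec A y π i j * bootVec A y π i (Sum.inr k)| ≤ bootBound A y π c := by
  have hr : 0 ≤ N / (∑ i ∈ A, samplingWeight π i) := div_nonneg (Nat.cast_nonneg _) hW.le
  rw [abs_mul, abs_of_nonneg hr]
  calc _ ≤ N / (∑ i ∈ A, samplingWeight π i) *
        ∑ i ∈ A, bootBound A y π c * bootVec A y π i (Sum.inr k) := by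
        gcongr
        refine (Finset.abs_sum_le_sum_abs _ _).trans (Finset.sum_le_sum fun i hi => ?_)
        rw [abs_mul, abs_of_nonneg (bootVec_inr_nonneg i k)]
        exact mul_le_mul_of_nonneg_right (abs_bootVec_le (hc i hi) j) (bootVec_inr_nonneg i k)
    _ = bootBound A y π c := by
        rw [← Finset.mul_sum, mul_left_comm, mean_bootVec_inr hN hW hp, mul_one]

/-- `n₀ N⁻² ∑_{i ∈ A} w_i² (1{y_i = k} - q_k) (1{y_i = l} - q_l)`. -/
def errorMoment (n₀ : ℝ) (A : Finset (Fin N)) (y : Fin N → Fin K) (π : Fin N → unitInterval)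
    (q : Fin K → ℝ) (k l : Fin K) : ℝ :=
  ∑ i ∈ A, n₀ / N ^ 2 * samplingWeight π i ^ 2 *
    (((if y i = k then 1 else 0) - q k) * ((if y i = l then 1 else 0) - q l))

theorem moment_bootVec_inl {n₀ : ℝ} (hn₀ : n₀ ≠ 0) (k l : Fin K) :
    ∑ i ∈ A, bootVec A y π i (Sum.inl k) * bootVec A y π i (Sum.inl l) =
      #A / n₀ * (errorMoment n₀ A y π (estProportion A y π) k l /
        (√(estProportion A y π k) * √(estProportion A y π l))) := by
  rw [errorMoment, Finset.sum_div, Finset.mul_sum]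
  refine Finset.sum_congr rfl fun i _ => ?_
  simp only [bootVec, Sum.elim_inl]
  have hs : √(#A : ℝ) * √(#A : ℝ) = #A := Real.mul_self_sqrt (Nat.cast_nonneg _)
  have e1 : (#A : ℝ) / n₀ * (n₀ / N ^ 2) = #A / N ^ 2 := by field_simp
  have e2 : ∀ x : ℝ, (#A : ℝ) / n₀ * (n₀ / N ^ 2 * x) = #A / N ^ 2 * x := fun x => by
    rw [← mul_assoc, e1]
  rw [mul_assoc (n₀ / N ^ 2), mul_div_assoc (n₀ / N ^ 2), e2]
  generalize √(#A : ℝ) = s at hs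
  rw [← hs]
  simp only [div_eq_mul_inv, mul_inv]
  ring

/-- The bootstrap centers at p̂, while the law of large numbers handles a fixed center. The
difference of the two products is linear in p̂ - q, and one factor w_i is absorbed by its bound of
order N / n₀. -/
theorem abs_errorMoment_sub_le {n₀ C : ℝ} (hn₀ : 0 < n₀) (hN : N ≠ 0)
    (hC : ∀ i ∈ A, samplingWeight π i ≤ C * (N / n₀)) (q : Fin K → ℝ) (hq0 : ∀ k, 0 ≤ q k)
    (hq1 : ∀ k, q k ≤ 1) (k l : Fin K) :
    |errorMoment n₀ A y π (estProportion A y π) k l - errorMoment n₀ A y π q k l| ≤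
      (|q k - estProportion A y π k| + |q l - estProportion A y π l|) *
        (C * ((∑ i ∈ A, samplingWeight π i) / N)) := by
  have hN' : (0 : ℝ) < N := Nat.cast_pos.2 (Nat.pos_of_ne_zero hN)
  set δ := |q k - estProportion A y π k| + |q l - estProportion A y π l| with hδ
  have hδ0 : 0 ≤ δ := by positivity
  rw [errorMoment, errorMoment, ← Finset.sum_sub_distrib, Finset.sum_div, Finset.mul_sum,
    Finset.mul_sum]
  refine (Finset.abs_sum_le_sum_abs _ _).trans (Finset.sum_le_sum fun i hi => ?_)
  have hw := samplingWeight_nonneg π i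
  rw [← mul_sub, abs_mul, abs_of_nonneg (by positivity), mul_comm]
  have h1 : n₀ / N ^ 2 * samplingWeight π i ^ 2 ≤ C * (samplingWeight π i / N) := by
    calc n₀ / N ^ 2 * samplingWeight π i ^ 2
        = n₀ / N ^ 2 * samplingWeight π i * samplingWeight π i := by ring
      _ ≤ n₀ / N ^ 2 * samplingWeight π i * (C * (N / n₀)) := by
          gcongr
          exact hC i hi
      _ = C * (samplingWeight π i / N) := by field_simp
  refine mul_le_mul ?_ h1 (by positivity) hδ0
  set a : ℝ := if y i = k then 1 else 0
  set b : ℝ := if y i = l then 1 else 0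
  have e : (a - estProportion A y π k) * (b - estProportion A y π l) - (a - q k) * (b - q l) =
      (q k - estProportion A y π k) * (b - estProportion A y π l) +
      (a - q k) * (q l - estProportion A y π l) := by ring
  rw [e]
  refine (abs_add_le _ _).trans ?_
  rw [abs_mul, abs_mul, hδ]
  have hb : |b - estProportion A y π l| ≤ 1 :=
    abs_indicator_sub_le (estProportion_nonneg l) (estProportion_le_one l) _
  have ha : |a - q k| ≤ 1 := abs_indicator_sub_le (hq0 k) (hq1 k) _
  exact add_le_add (mul_le_of_le_one_right (abs_nonneg _) hb)
    (mul_le_of_le_one_left (abs_nonneg _) ha)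

/-- The centered indicators sum to zero over the categories, so the moments of the first d
categories determine those involving the last one. -/
theorem errorMoment_eq_zeroSumExt {d : ℕ} {y : Fin N → Fin (d + 1)} (n₀ : ℝ)
    (q : Fin (d + 1) → ℝ) (hq : ∑ k, q k = 1) (k l : Fin (d + 1)) :
    errorMoment n₀ A y π q k l = ∑ a, ∑ b, zeroSumExt d k a * zeroSumExt d l b *
      errorMoment n₀ A y π q a.castSucc b.castSucc := by
  have hz : ∀ i, ∑ k, ((if y i = k then 1 else 0) - q k) = 0 := fun i => by
    rw [Finset.sum_sub_distrib, hq, Finset.sum_ite_eq]; simp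
  simp only [errorMoment, Finset.mul_sum]
  rw [Finset.sum_congr rfl fun a _ => Finset.sum_comm, Finset.sum_comm]
  refine Finset.sum_congr rfl fun i _ => ?_
  conv_lhs => rw [← sum_zeroSumExt_mul _ (hz i) k, ← sum_zeroSumExt_mul _ (hz i) l,
    Finset.sum_mul_sum, Finset.mul_sum]
  refine Finset.sum_congr rfl fun a _ => ?_
  rw [Finset.mul_sum]
  exact Finset.sum_congr rfl fun b _ => by ring

end

/-! ### Weak convergence of the bootstrap statistics along a sequence of samples -/

section

variable {d : ℕ} {N : ℕ → ℕ} {A : ∀ t, Finset (Fin (N t))} {y : ∀ t, Fin (N t) → Fin (d + 1)}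
  {π : ∀ t, Fin (N t) → unitInterval}

/-- Clipping the total weight at `1 / 2` from below makes `ratioMap` continuous. -/
theorem continuous_ratioMap_clip {K : ℕ} {h : ℝ → ℝ} (hh : Continuous h) :
    Continuous fun v : BootSpace K => ratioMap h v (max (v (Sum.inr (Sum.inr ()))) (1 / 2)) := by
  have hne : ∀ v : BootSpace K, max (v (Sum.inr (Sum.inr ()))) (1 / 2) ≠ 0 := fun v =>
    (lt_of_lt_of_le (by norm_num) (le_max_right _ _)).ne'
  unfold ratioMap
  refine continuous_finsetSum _ fun k _ => ?_
  refine Continuous.mul ?_ (hh.comp ?_)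
  · exact (Continuous.div (by fun_prop) (by fun_prop) hne).pow 2
  · exact Continuous.div (by fun_prop) (by fun_prop) hne

/-- A continuous mapping argument for a map that is not continuous at zero total weight: the
statistic is compared with its clipped version, which differs only where the total weight is below 1
/ 2. -/
theorem tendsto_integral_stat (stat : ∀ t, (Fin (N t) → ℕ) → ℝ) {h : ℝ → ℝ} (hh : Continuous h)
    (h1 : h 1 = 1) (hW : ∀ t, 0 < ∑ i ∈ A t, samplingWeight (π t) i)
    (hstat : ∀ t m, bootSum (A t) (y t) (π t) m (Sum.inr (Sum.inr ())) ≠ 0 →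
      stat t m = ratioMap h (bootSum (A t) (y t) (π t) m)
        (bootSum (A t) (y t) (π t) m (Sum.inr (Sum.inr ()))))
    {G : Matrix (Fin (d + 1)) (Fin d) ℝ} {l : Fin d → ℝ}
    (hG : G.transpose * G = Matrix.diagonal l)
    (hlim : ∀ F : BoundedContinuousFunction (BootSpace (d + 1)) ℝ, Tendsto
      (fun t => ∫ m, F (bootSum (A t) (y t) (π t) m) ∂(bootstrapLaw (A t) (π t))) atTop
      (𝓝 (∫ z, F z ∂(limitLaw G))))
    (f : BoundedContinuousFunction ℝ ℝ) :
    Tendsto (fun t => ∫ x, f x ∂((bootstrapLaw (A t) (π t)).map (stat t))) atTop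
      (𝓝 (∫ x, f x ∂(weightedChiSq l))) := by
  have hprob : ∀ t, IsProbabilityMeasure (bootstrapLaw (A t) (π t)) :=
    fun t => isProbabilityMeasure_bootstrapLaw (A t) (π t) (hW t)
  let Φ : BoundedContinuousFunction (BootSpace (d + 1)) ℝ :=
    f.compContinuous ⟨_, continuous_ratioMap_clip hh⟩
  -- `ψ` is 1 wherever the clipping acts and 0 at total weight 1, so its integral bounds the
  -- probability of clipping and tends to 0.
  let ψ : BoundedContinuousFunction (BootSpace (d + 1)) ℝ :=
    BoundedContinuousFunction.mkOfBound
      ⟨fun v => min (2 * |v (Sum.inr (Sum.inr ())) - 1|) 1, by fun_prop⟩ 1 fun v w => by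
        rw [Real.dist_eq, abs_le]
        have a1 := min_le_right (2 * |v (Sum.inr (Sum.inr ())) - 1|) (1 : ℝ)
        have a2 := min_le_right (2 * |w (Sum.inr (Sum.inr ())) - 1|) (1 : ℝ)
        have a3 : 0 ≤ min (2 * |v (Sum.inr (Sum.inr ())) - 1|) (1 : ℝ) := by positivity
        have a4 : 0 ≤ min (2 * |w (Sum.inr (Sum.inr ())) - 1|) (1 : ℝ) := by positivity
        exact ⟨by simp only [ContinuousMap.coe_mk]; linarith,
          by simp only [ContinuousMap.coe_mk]; linarith⟩
  have hΦ := hlim Φ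
  have hψ := hlim ψ
  have hm := (continuous_limitPoint G).measurable
  have hΦlim : ∫ z, Φ z ∂(limitLaw G) = ∫ x, f x ∂(weightedChiSq l) := by
    have hmeas : Measurable fun z : Fin d → ℝ => ∑ k, l k * z k ^ 2 := by fun_prop
    rw [limitLaw, integral_map hm.aemeasurable Φ.continuous.aestronglyMeasurable, weightedChiSq,
      integral_map hmeas.aemeasurable f.continuous.aestronglyMeasurable]
    congr 1
    ext z
    change f (ratioMap h (limitPoint G z) (max 1 (1 / 2))) = _
    rw [max_eq_left (by norm_num), ratioMap_limitPoint G l hG h h1]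
  have hψlim : ∫ z, ψ z ∂(limitLaw G) = 0 := by
    rw [limitLaw, integral_map hm.aemeasurable ψ.continuous.aestronglyMeasurable]
    have : ∀ z, ψ (limitPoint G z) = 0 := fun z => by
      change min (2 * |(1 : ℝ) - 1|) 1 = 0
      simp
    simp [this]
  rw [hΦlim] at hΦ
  rw [hψlim] at hψ
  have hdiff : Tendsto (fun t => ∫ m, f (stat t m) ∂(bootstrapLaw (A t) (π t)) -
      ∫ m, Φ (bootSum (A t) (y t) (π t) m) ∂(bootstrapLaw (A t) (π t))) atTop (𝓝 0) := by
    refine squeeze_zero_norm (a := fun t => 2 * ‖f‖ *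
      ∫ m, ψ (bootSum (A t) (y t) (π t) m) ∂(bootstrapLaw (A t) (π t))) (fun t => ?_)
      (by simpa using hψ.const_mul (2 * ‖f‖))
    have i1 : Integrable (fun m => f (stat t m)) (bootstrapLaw (A t) (π t)) :=
      Integrable.of_bound Measurable.of_discrete.aestronglyMeasurable ‖f‖
        (ae_of_all _ fun m => f.norm_coe_le_norm _)
    have i2 : Integrable (fun m => Φ (bootSum (A t) (y t) (π t) m)) (bootstrapLaw (A t) (π t)) :=
      Integrable.of_bound Measurable.of_discrete.aestronglyMeasurable ‖Φ‖
        (ae_of_all _ fun m => Φ.norm_coe_le_norm _)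
    have i3 : Integrable (fun m => ψ (bootSum (A t) (y t) (π t) m)) (bootstrapLaw (A t) (π t)) :=
      Integrable.of_bound Measurable.of_discrete.aestronglyMeasurable ‖ψ‖
        (ae_of_all _ fun m => ψ.norm_coe_le_norm _)
    rw [← integral_sub i1 i2, ← integral_const_mul]
    refine norm_integral_le_of_norm_le (i3.const_mul _) (ae_of_all _ fun m => ?_)
    set v := bootSum (A t) (y t) (π t) m with hv
    change ‖f (stat t m) - f (ratioMap h v (max (v (Sum.inr (Sum.inr ()))) (1 / 2)))‖ ≤
      2 * ‖f‖ * min (2 * |v (Sum.inr (Sum.inr ())) - 1|) 1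
    by_cases hD : v (Sum.inr (Sum.inr ())) < 1 / 2
    · rw [min_eq_right (by rw [abs_of_neg (by linarith)]; linarith), mul_one]
      refine (norm_sub_le _ _).trans ?_
      have := f.norm_coe_le_norm (stat t m)
      have := f.norm_coe_le_norm (ratioMap h v (max (v (Sum.inr (Sum.inr ()))) (1 / 2)))
      linarith
    · push Not at hD
      rw [hstat t m (by rw [← hv]; linarith), max_eq_left hD, sub_self, norm_zero]
      positivity
  have := hdiff.add hΦ
  rw [zero_add] at this
  refine this.congr fun t => ?_
  rw [integral_map Measurable.of_discrete.aemeasurable f.continuous.aestronglyMeasurable]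
  ring

end

section

variable {d : ℕ} {N : ℕ → ℕ} {A : ∀ t, Finset (Fin (N t))} {y : ∀ t, Fin (N t) → Fin (d + 1)}
  {π : ∀ t, Fin (N t) → unitInterval}

/-- The hypotheses of the bootstrap central limit theorem are checked for `bootVec`: first moments
hold exactly, error second moments come from `errorMoment`, and the rest vanish. -/
theorem tendsto_integral_bootSum {p : Fin (d + 1) → ℝ} (hp : ∀ k, 0 < p k) (hsum : ∑ k, p k = 1)
    {n₀ : ℕ → ℝ} (hn₀ : Tendsto n₀ atTop atTop) (hn₀pos : ∀ t, 0 < n₀ t)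
    {C : ℝ} (hπ : ∀ t, ∀ i ∈ A t, 0 < (π t i : ℝ))
    (hC : ∀ t, ∀ i ∈ A t, samplingWeight (π t) i ≤ C * (N t / n₀ t))
    (hWpos : ∀ t k, 0 < ∑ i ∈ A t with y t i = k, samplingWeight (π t) i)
    (hsize : Tendsto (fun t => (#(A t) : ℝ) / n₀ t) atTop (𝓝 1))
    (hWk : ∀ k, Tendsto (fun t => (∑ i ∈ A t with y t i = k, samplingWeight (π t) i) / N t) atTop
      (𝓝 (p k)))
    {S : Matrix (Fin d) (Fin d) ℝ}
    (hS : ∀ k l : Fin d, Tendsto (fun t => errorMoment (n₀ t) (A t) (y t) (π t) p k.castSucc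
      l.castSucc) atTop (𝓝 (S k l)))
    {G : Matrix (Fin (d + 1)) (Fin d) ℝ}
    (hG : G * G.transpose = scaledExt p * S * (scaledExt p).transpose)
    (F : BoundedContinuousFunction (BootSpace (d + 1)) ℝ) :
    Tendsto (fun t => ∫ m, F (bootSum (A t) (y t) (π t) m) ∂(bootstrapLaw (A t) (π t))) atTop
      (𝓝 (∫ z, F z ∂(limitLaw G))) := by
  have hWeq : ∀ t, ∑ i ∈ A t, samplingWeight (π t) i =
      ∑ k, ∑ i ∈ A t with y t i = k, samplingWeight (π t) i := fun t =>
    (Finset.sum_fiberwise _ _ _).symm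
  have hW : ∀ t, 0 < ∑ i ∈ A t, samplingWeight (π t) i := fun t => by
    rw [hWeq]
    exact Finset.sum_pos (fun k _ => hWpos t k) Finset.univ_nonempty
  have hN : ∀ t, N t ≠ 0 := by
    intro t h0
    obtain ⟨i, -⟩ := Finset.nonempty_of_sum_ne_zero (hW t).ne'
    exact (Fin.pos i).ne' h0
  have hNpos : ∀ t, (0 : ℝ) < N t := fun t => Nat.cast_pos.2 (Nat.pos_of_ne_zero (hN t))
  have hpos : ∀ t k, 0 < estProportion (A t) (y t) (π t) k := fun t k => div_pos (hWpos t k) (hW t)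
  have hcard : Tendsto (fun t => (#(A t) : ℝ)) atTop atTop := by
    refine (hsize.pos_mul_atTop one_pos hn₀).congr fun t => ?_
    have := (hn₀pos t).ne'
    field_simp
  -- The population size is at least #A, which is asymptotic to `n₀`.
  have hNinf : Tendsto N atTop atTop := by
    rw [← tendsto_natCast_atTop_iff (R := ℝ)]
    refine tendsto_atTop_mono (fun t => ?_) hcard
    exact_mod_cast (Finset.card_le_univ (A t)).trans_eq (Fintype.card_fin _)
  have hWN : Tendsto (fun t => (∑ i ∈ A t, samplingWeight (π t) i) / N t) atTop (𝓝 1) := by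
    have := tendsto_finsetSum Finset.univ fun k _ => hWk k
    rw [hsum] at this
    refine this.congr fun t => ?_
    rw [← Finset.sum_div, hWeq]
  have hr : Tendsto (fun t => N t / ∑ i ∈ A t, samplingWeight (π t) i) atTop (𝓝 1) := by
    have := hWN.inv₀ one_ne_zero
    rw [inv_one] at this
    exact this.congr fun t => inv_div _ _
  have hest : ∀ k, Tendsto (fun t => estProportion (A t) (y t) (π t) k) atTop (𝓝 (p k)) := by
    intro k
    have := (hWk k).div hWN one_ne_zero
    rw [div_one] at this
    refine this.congr fun t => ?_
    have := (hNpos t).ne'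
    have := (hW t).ne'
    simp only [Pi.div_apply, estProportion, weightedProportion]
    field_simp
  have hsqrt : ∀ k, Tendsto (fun t => √(estProportion (A t) (y t) (π t) k)) atTop
      (𝓝 (√(p k))) := fun k => (Real.continuous_sqrt.tendsto _).comp (hest k)
  have hsqrt0 : ∀ k, √(p k) ≠ 0 := fun k => (Real.sqrt_pos.2 (hp k)).ne'
  have hc : ∀ t, ∀ i ∈ A t, samplingWeight (π t) i / N t ≤ C / n₀ t := by
    intro t i hi
    have h0 := hNpos t
    rw [div_le_iff₀ h0]
    refine (hC t i hi).trans_eq ?_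
    ring
  have hcn : Tendsto (fun t => C / n₀ t) atTop (𝓝 0) := hn₀.const_div_atTop C
  -- Uniform smallness of the errors: √n times w_i / N = O(1 / n₀) is of order 1 / √n₀.
  have hcsqrt : Tendsto (fun t => √(#(A t) : ℝ) * (C / n₀ t)) atTop (𝓝 0) := by
    have h1 : Tendsto (fun t => √((#(A t) : ℝ) / n₀ t)) atTop (𝓝 √1) :=
      (Real.continuous_sqrt.tendsto _).comp hsize
    have h2 : Tendsto (fun t => C / √(n₀ t)) atTop (𝓝 0) :=
      (Real.tendsto_sqrt_atTop.comp hn₀).const_div_atTop C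
    have := h1.mul h2
    rw [mul_zero] at this
    refine this.congr fun t => ?_
    rw [Real.sqrt_div (Nat.cast_nonneg _), div_mul_div_comm, Real.mul_self_sqrt (hn₀pos t).le]
    ring
  have hb : Tendsto (fun t => bootBound (A t) (y t) (π t) (C / n₀ t)) atTop (𝓝 0) := by
    have h1 := tendsto_finsetSum Finset.univ fun k _ => hcsqrt.div (hsqrt k) (hsqrt0 k)
    have h2 := tendsto_finsetSum Finset.univ fun k _ => hcn.div (hest k) (hp k).ne'
    have := (h1.add h2).add hcn
    simp only [zero_div, Finset.sum_const_zero, add_zero] at this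
    refine this.congr fun t => ?_
    simp only [bootBound, Pi.div_apply]
    congr 2
    exact Finset.sum_congr rfl fun k _ => by ring
  have hp1 : ∀ k, p k ≤ 1 := fun k => by
    rw [← hsum]; exact Finset.single_le_sum (fun k _ => (hp k).le) (Finset.mem_univ k)
  have herr : ∀ k l, Tendsto (fun t => errorMoment (n₀ t) (A t) (y t) (π t) p k l) atTop
      (𝓝 (∑ a, ∑ b, zeroSumExt d k a * zeroSumExt d l b * S a b)) := by
    intro k l
    simp_rw [fun t => errorMoment_eq_zeroSumExt (A := A t) (π := π t) (y := y t) (n₀ t) p hsum k l]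
    exact tendsto_finsetSum _ fun a _ => tendsto_finsetSum _ fun b _ => (hS a b).const_mul _
  have herr' : ∀ k l, Tendsto (fun t => errorMoment (n₀ t) (A t) (y t) (π t)
      (estProportion (A t) (y t) (π t)) k l) atTop
      (𝓝 (∑ a, ∑ b, zeroSumExt d k a * zeroSumExt d l b * S a b)) := by
    intro k l
    have hδ : ∀ k, Tendsto (fun t => |p k - estProportion (A t) (y t) (π t) k|) atTop (𝓝 0) := by
      intro k
      have := ((hest k).const_sub (p k)).abs
      rwa [sub_self, abs_zero] at this
    have hd : Tendsto (fun t => errorMoment (n₀ t) (A t) (y t) (π t)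
        (estProportion (A t) (y t) (π t)) k l - errorMoment (n₀ t) (A t) (y t) (π t) p k l)
        atTop (𝓝 0) := by
      refine squeeze_zero_norm (fun t => abs_errorMoment_sub_le (hn₀pos t) (hN t) (hC t) p
        (fun k => (hp k).le) hp1 k l) ?_
      simpa using ((hδ k).add (hδ l)).mul (hWN.const_mul C)
    have := hd.add (herr k l)
    rw [zero_add] at this
    exact this.congr fun t => by ring
  have hb0 : ∀ (j : Fin (d + 1) ⊕ Fin (d + 1) ⊕ Unit) (k : Fin (d + 1) ⊕ Unit),
      Tendsto (fun t => N t / (∑ i ∈ A t, samplingWeight (π t) i) * ∑ i ∈ A t,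
        bootVec (A t) (y t) (π t) i j * bootVec (A t) (y t) (π t) i (Sum.inr k)) atTop (𝓝 0) :=
    fun j k => squeeze_zero_norm (fun t => abs_moment_bootVec_le (hN t) (hW t) (hpos t) (hc t) j k)
      hb
  refine tendsto_integral_bootstrap_sum hNinf hW hπ (fun t => bootVec (A t) (y t) (π t)) _ hb
    (fun t i hi j => abs_bootVec_le (hc t i hi) j) (limitMean (d + 1))
    (limitCov (G * G.transpose)) ?_ ?_ (limitLaw G) (charFun_limitLaw G) F
  · rintro (k | j)
    · simp_rw [fun t => sum_bootVec_error (A := A t) (y := y t) (hW t) k, mul_zero]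
      exact tendsto_const_nhds
    · simp_rw [fun t => mean_bootVec_inr (hN t) (hW t) (hpos t) j]
      exact tendsto_const_nhds
  · rintro (k | j) (l | j')
    · have hval : limitCov (G * G.transpose) (Sum.inl k) (Sum.inl l) =
          1 * (1 * ((∑ a, ∑ b, zeroSumExt d k a * zeroSumExt d l b * S a b) /
            (√(p k) * √(p l)))) := by
        rw [limitCov, Sum.elim_inl, Sum.elim_inl, hG]
        simp only [Matrix.mul_apply, Matrix.transpose_apply, scaledExt, one_mul, Finset.sum_mul,
          Finset.sum_div]
        rw [Finset.sum_comm]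
        refine Finset.sum_congr rfl fun a _ => Finset.sum_congr rfl fun b _ => ?_
        have := hsqrt0 k
        have := hsqrt0 l
        field_simp
      rw [hval]
      have := hr.mul (hsize.mul ((herr' k l).div ((hsqrt k).mul (hsqrt l))
        (mul_ne_zero (hsqrt0 k) (hsqrt0 l))))
      refine this.congr fun t => ?_
      rw [moment_bootVec_inl (hn₀pos t).ne']
      rfl
    · exact hb0 (Sum.inl k) j'
    · simp_rw [mul_comm (bootVec _ _ _ _ (Sum.inr j))]
      exact hb0 (Sum.inl l) j
    · exact hb0 (Sum.inr j) j'

/-- Along a sequence of samples with the asymptotic properties of a Poisson sample, the bootstrap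
laws of both statistics converge weakly. -/
theorem tendsto_integral_bootLaws {p : Fin (d + 1) → ℝ} (hp : ∀ k, 0 < p k) (hsum : ∑ k, p k = 1)
    {n₀ : ℕ → ℝ} (hn₀ : Tendsto n₀ atTop atTop)
    {C : ℝ} (hπ : ∀ t, ∀ i ∈ A t, 0 < (π t i : ℝ))
    (hC : ∀ t, ∀ i ∈ A t, samplingWeight (π t) i ≤ C * (N t / n₀ t))
    (hsize : Tendsto (fun t => (#(A t) : ℝ) / n₀ t) atTop (𝓝 1))
    (hWk : ∀ k, Tendsto (fun t => (∑ i ∈ A t with y t i = k, samplingWeight (π t) i) / N t) atTop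
      (𝓝 (p k)))
    {S : Matrix (Fin d) (Fin d) ℝ}
    (hS : ∀ k l : Fin d, Tendsto (fun t => errorMoment (n₀ t) (A t) (y t) (π t) p k.castSucc
      l.castSucc) atTop (𝓝 (S k l)))
    {G : Matrix (Fin (d + 1)) (Fin d) ℝ} {l : Fin d → ℝ}
    (hG : G * G.transpose = scaledExt p * S * (scaledExt p).transpose)
    (hGl : G.transpose * G = Matrix.diagonal l) (f : BoundedContinuousFunction ℝ ℝ) :
    Tendsto (fun t => ∫ x, f x ∂(bootPearsonLaw (A t) (y t) (π t))) atTop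
      (𝓝 (∫ x, f x ∂(weightedChiSq l))) ∧
    Tendsto (fun t => ∫ x, f x ∂(bootLRLaw (A t) (y t) (π t))) atTop
      (𝓝 (∫ x, f x ∂(weightedChiSq l))) := by
  -- Positivity of all category weights holds only eventually; shifting the sequence by `T` makes it
  -- hold throughout.
  have hev : ∀ᶠ t in atTop, 0 < n₀ t ∧
      ∀ k, 0 < ∑ i ∈ A t with y t i = k, samplingWeight (π t) i := by
    refine (hn₀.eventually_gt_atTop 0).and ?_
    rw [eventually_all]
    intro k
    filter_upwards [(hWk k).eventually (lt_mem_nhds (hp k))] with t ht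
    by_contra hcon
    exact ht.not_ge (div_nonpos_of_nonpos_of_nonneg (not_lt.1 hcon) (Nat.cast_nonneg _))
  obtain ⟨T, hT⟩ := eventually_atTop.1 hev
  have hs : Tendsto (fun t => t + T) atTop atTop := tendsto_add_atTop_nat T
  have hT' : ∀ t, 0 < n₀ (t + T) ∧ ∀ k, 0 < ∑ i ∈ A (t + T) with y (t + T) i = k,
      samplingWeight (π (t + T)) i := fun t => hT _ (Nat.le_add_left _ _)
  have hlim := tendsto_integral_bootSum (A := fun t => A (t + T)) (y := fun t => y (t + T))
    (π := fun t => π (t + T)) hp hsum (hn₀.comp hs) (fun t => (hT' t).1) (fun t => hπ _)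
    (fun t => hC _) (fun t => (hT' t).2) (hsize.comp hs) (fun k => (hWk k).comp hs)
    (fun k l => (hS k l).comp hs) hG
  have hW : ∀ t, 0 < ∑ i ∈ A (t + T), samplingWeight (π (t + T)) i := fun t => by
    rw [← Finset.sum_fiberwise _ (y (t + T))]
    exact Finset.sum_pos (fun k _ => (hT' t).2 k) Finset.univ_nonempty
  have hpos : ∀ t k, 0 < estProportion (A (t + T)) (y (t + T)) (π (t + T)) k :=
    fun t k => div_pos ((hT' t).2 k) (hW t)
  constructor
  · rw [← tendsto_add_atTop_iff_nat T]
    refine tendsto_integral_stat _ (h := fun _ => 1) continuous_const rfl hW (fun t m hD => ?_) hGl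
      hlim f
    rw [pearsonStat_eq_ratioStat]
    exact ratioStat_bootProportion _ _ _ _ _ (hpos t) hD
  · rw [← tendsto_add_atTop_iff_nat T]
    refine tendsto_integral_stat _ continuous_lrRatio lrRatio_one hW (fun t m hD => ?_) hGl hlim f
    rw [lrStat_bootProportion _ _ _ _ (hpos t) (hW t) hD]
    exact ratioStat_bootProportion _ _ _ _ _ (hpos t) hD

end

/-! ### Moments of sums over a Poisson sample -/

/-- Expand ∏ (x_i + c_i) with c_i = 0 on `T` and 1 - x_i elsewhere: exactly the subsets containing
`T` survive. This gives the joint inclusion probabilities of Poisson sampling. -/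
theorem sum_superset_prod {N : ℕ} (x : Fin N → ℝ) (T : Finset (Fin N)) :
    ∑ s with T ⊆ s, (∏ i ∈ s, x i) * ∏ i ∈ sᶜ, (1 - x i) = ∏ i ∈ T, x i := by
  have h := Finset.prod_add x (fun i => if i ∈ T then 0 else 1 - x i) Finset.univ
  have hl : ∏ i, (x i + if i ∈ T then 0 else 1 - x i) = ∏ i ∈ T, x i := by
    rw [← Finset.prod_subset (Finset.subset_univ T) fun i _ hi => by rw [if_neg hi]; ring]
    exact Finset.prod_congr rfl fun i hi => by rw [if_pos hi, add_zero]
  rw [← hl, h, Finset.powerset_univ, Finset.sum_filter]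
  refine Finset.sum_congr rfl fun s _ => ?_
  rw [← Finset.compl_eq_univ_sdiff]
  split_ifs with hs
  · congr 1
    refine Finset.prod_congr rfl fun i hi => ?_
    rw [if_neg fun hT => Finset.mem_compl.1 hi (hs hT)]
  · obtain ⟨i, hiT, his⟩ := Finset.not_subset.1 hs
    have h0 : ∏ i ∈ sᶜ, (if i ∈ T then 0 else 1 - x i) = 0 :=
      Finset.prod_eq_zero (Finset.mem_compl.2 his) (if_pos hiT)
    rw [h0, mul_zero]

section

variable {Ω : Type*} [mΩ : MeasurableSpace Ω] {P : Measure Ω} {N K : ℕ}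
  {y : Fin N → Ω → Fin K} {π : Fin N → Ω → unitInterval} {A : Ω → Finset (Fin N)}

theorem IsPoissonSample.measurableSet_preimage (hA : IsPoissonSample P y π A)
    (B : Set (Finset (Fin N))) : MeasurableSet (A ⁻¹' B) := by
  rw [← Set.biUnion_preimage_singleton]
  exact MeasurableSet.biUnion B.to_countable fun s _ => hA.1 s

theorem IsPoissonSample.measurable_term {φ : Fin N → Fin K × unitInterval → ℝ}
    (hA : IsPoissonSample P y π A)
    (hy : ∀ i, Measurable (y i)) (hπ : ∀ i, Measurable (π i)) (hφ : ∀ i, Measurable (φ i))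
    (i : Fin N) : Measurable fun ω => if i ∈ A ω then φ i (y i ω, π i ω) else 0 :=
  Measurable.ite (hA.measurableSet_preimage {s | i ∈ s}) ((hφ i).comp ((hy i).prodMk (hπ i)))
    measurable_const

variable [IsProbabilityMeasure P]

/-- Given the population, `φ` is constant and can be pulled out of the conditional expectation of
each event A = s; then sum over the sets s containing `T`. -/
theorem IsPoissonSample.integral_subset (hA : IsPoissonSample P y π A)
    (hy : ∀ i, Measurable (y i)) (hπ : ∀ i, Measurable (π i)) (T : Finset (Fin N))
    {φ : (Fin N → Fin K × unitInterval) → ℝ} (hφ : Measurable φ)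
    (hint : Integrable (fun ω => φ fun i => (y i ω, π i ω)) P) :
    ∫ ω, (if T ⊆ A ω then φ (fun i => (y i ω, π i ω)) else 0) ∂P =
      ∫ ω, (∏ i ∈ T, (π i ω : ℝ)) * φ (fun i => (y i ω, π i ω)) ∂P := by
  set X : Ω → Fin N → Fin K × unitInterval := fun ω i => (y i ω, π i ω) with hX
  have hXm : Measurable X := measurable_pi_lambda _ fun i => (hy i).prodMk (hπ i)
  have hm : MeasurableSpace.comap X inferInstance ≤ mΩ := hXm.comap_le
  have hZ : StronglyMeasurable[MeasurableSpace.comap X inferInstance] fun ω => φ (X ω) :=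
    (hφ.comp (comap_measurable X)).stronglyMeasurable
  have hbd : ∀ (u : Ω → ℝ), Measurable u → (∀ ω, |u ω| ≤ 1) →
      Integrable (fun ω => u ω * φ (X ω)) P := fun u hu hu1 =>
    hint.bdd_mul (c := 1) hu.aestronglyMeasurable (ae_of_all _ hu1)
  have hind1 : ∀ (s : Finset (Fin N)) (ω : Ω),
      |(A ⁻¹' {s}).indicator (fun _ => (1 : ℝ)) ω| ≤ 1 := fun s ω => by
    rw [← Real.norm_eq_abs]
    exact (norm_indicator_le_norm_self (fun _ => (1 : ℝ)) ω).trans norm_one.le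
  have hone : ∀ s : Finset (Fin N), ∫ ω, (A ⁻¹' {s}).indicator (fun _ => (1 : ℝ)) ω * φ (X ω) ∂P =
      ∫ ω, ((∏ i ∈ s, (π i ω : ℝ)) * ∏ i ∈ sᶜ, (1 - (π i ω : ℝ))) * φ (X ω) ∂P := by
    intro s
    have hmeas : Measurable ((A ⁻¹' {s}).indicator fun _ => (1 : ℝ)) :=
      measurable_const.indicator (hA.1 s)
    have i1 : Integrable ((A ⁻¹' {s}).indicator fun _ => (1 : ℝ)) P :=
      (integrable_const 1).indicator (hA.1 s)
    have i2 : Integrable ((A ⁻¹' {s}).indicator (fun _ => (1 : ℝ)) * fun ω => φ (X ω)) P :=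
      hbd _ hmeas (hind1 s)
    have hpull := condExp_mul_of_stronglyMeasurable_right hZ i2 i1
    calc _ = ∫ ω, (P[(A ⁻¹' {s}).indicator (fun _ => (1 : ℝ)) * (fun ω => φ (X ω)) |
          MeasurableSpace.comap X inferInstance]) ω ∂P := (integral_condExp hm).symm
      _ = _ := by
        refine integral_congr_ae ?_
        filter_upwards [hpull, hA.2 s] with ω h1 h2
        rw [h1, Pi.mul_apply, h2]
  have hπm : ∀ i, Measurable fun ω => (π i ω : ℝ) := fun i => measurable_subtype_coe.comp (hπ i)
  calc ∫ ω, (if T ⊆ A ω then φ (X ω) else 0) ∂P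
      = ∫ ω, ∑ s with T ⊆ s, (A ⁻¹' {s}).indicator (fun _ => (1 : ℝ)) ω * φ (X ω) ∂P := by
        congr 1
        ext ω
        rw [← Finset.sum_mul, Finset.sum_filter]
        rw [Finset.sum_eq_single (A ω) (fun s _ hs => by
          split_ifs
          · exact Set.indicator_of_notMem (s := A ⁻¹' {s})
              (fun h => hs (Set.mem_singleton_iff.1 h).symm) _
          · rfl) (by simp), Set.indicator_of_mem (s := A ⁻¹' {A ω}) rfl]
        split_ifs <;> simp
    _ = ∑ s with T ⊆ s, ∫ ω, ((∏ i ∈ s, (π i ω : ℝ)) * ∏ i ∈ sᶜ, (1 - (π i ω : ℝ))) *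
          φ (X ω) ∂P := by
        rw [integral_finsetSum]
        · exact Finset.sum_congr rfl fun s _ => hone s
        · intro s _
          exact hbd _ (measurable_const.indicator (hA.1 s)) (hind1 s)
    _ = _ := by
        rw [← integral_finsetSum]
        · congr 1
          ext ω
          rw [← Finset.sum_mul, sum_superset_prod]
        · intro s _
          refine hbd _ (by fun_prop) fun ω => ?_
          rw [abs_mul, Finset.abs_prod, Finset.abs_prod]
          refine mul_le_one₀ ?_ (Finset.prod_nonneg fun _ _ => abs_nonneg _) ?_ <;>
          refine Finset.prod_le_one (fun _ _ => abs_nonneg _) fun i _ => ?_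
          · rw [abs_of_nonneg (π i ω).2.1]; exact (π i ω).2.2
          · rw [abs_of_nonneg (sub_nonneg.2 (π i ω).2.2)]; linarith [(π i ω).2.1]

variable {φ ψ : Fin N → Fin K × unitInterval → ℝ} {M : ℝ}

theorem integrable_of_ae_abs_le {u : Ω → ℝ} (hu : Measurable u) (h : ∀ᵐ ω ∂P, |u ω| ≤ M) :
    Integrable u P :=
  Integrable.of_bound hu.aestronglyMeasurable M h

theorem IsPoissonSample.memLp_term (hA : IsPoissonSample P y π A)
    (hy : ∀ i, Measurable (y i)) (hπ : ∀ i, Measurable (π i)) (hφ : ∀ i, Measurable (φ i))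
    (hbd : ∀ i, ∀ᵐ ω ∂P, |φ i (y i ω, π i ω)| ≤ M) (i : Fin N) :
    MemLp (fun ω => if i ∈ A ω then φ i (y i ω, π i ω) else 0) 2 P := by
  refine MemLp.of_bound (hA.measurable_term hy hπ hφ i).aestronglyMeasurable M ?_
  filter_upwards [hbd i] with ω h
  split_ifs
  · exact h
  · rw [norm_zero]; exact (abs_nonneg _).trans h

theorem IsPoissonSample.integral_term (hA : IsPoissonSample P y π A)
    (hy : ∀ i, Measurable (y i)) (hπ : ∀ i, Measurable (π i)) (hφ : ∀ i, Measurable (φ i))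
    (hbd : ∀ i, ∀ᵐ ω ∂P, |φ i (y i ω, π i ω)| ≤ M) (i : Fin N) :
    ∫ ω, (if i ∈ A ω then φ i (y i ω, π i ω) else 0) ∂P =
      ∫ ω, (π i ω : ℝ) * φ i (y i ω, π i ω) ∂P := by
  have hm : Measurable fun ω => φ i (y i ω, π i ω) := (hφ i).comp ((hy i).prodMk (hπ i))
  have := hA.integral_subset hy hπ {i} (φ := fun x => φ i (x i))
    ((hφ i).comp (measurable_pi_apply i))
    (integrable_of_ae_abs_le hm (hbd i))
  simpa only [Finset.singleton_subset_iff, Finset.prod_singleton] using this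

/-- For distinct units the joint inclusion probability is π_i π_j, and independence of the units
factors the expectation, so the covariance vanishes. -/
theorem IsPoissonSample.covariance_term (hA : IsPoissonSample P y π A)
    (hy : ∀ i, Measurable (y i)) (hπ : ∀ i, Measurable (π i))
    (hindep : iIndepFun (fun i ω => (y i ω, π i ω)) P)
    (hφ : ∀ i, Measurable (φ i)) (hψ : ∀ i, Measurable (ψ i))
    (hφM : ∀ i, ∀ᵐ ω ∂P, |φ i (y i ω, π i ω)| ≤ M) (hψM : ∀ i, ∀ᵐ ω ∂P, |ψ i (y i ω, π i ω)| ≤ M)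
    (i j : Fin N) :
    covariance (fun ω => if i ∈ A ω then φ i (y i ω, π i ω) else 0)
      (fun ω => if j ∈ A ω then ψ j (y j ω, π j ω) else 0) P =
    if i = j then ∫ ω, (π i ω : ℝ) * (φ i (y i ω, π i ω) * ψ i (y i ω, π i ω)) ∂P -
      (∫ ω, (π i ω : ℝ) * φ i (y i ω, π i ω) ∂P) * ∫ ω, (π i ω : ℝ) * ψ i (y i ω, π i ω) ∂P
    else 0 := by
  have hmφ : ∀ i, Measurable fun ω => φ i (y i ω, π i ω) :=
    fun i => (hφ i).comp ((hy i).prodMk (hπ i))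
  have hmψ : ∀ i, Measurable fun ω => ψ i (y i ω, π i ω) :=
    fun i => (hψ i).comp ((hy i).prodMk (hπ i))
  have hprodM : ∀ i j, ∀ᵐ ω ∂P, |φ i (y i ω, π i ω) * ψ j (y j ω, π j ω)| ≤ M * M := by
    intro i j
    filter_upwards [hφM i, hψM j] with ω h1 h2
    rw [abs_mul]
    exact mul_le_mul h1 h2 (abs_nonneg _) ((abs_nonneg _).trans h1)
  rw [covariance_eq_sub (hA.memLp_term hy hπ hφ hφM i) (hA.memLp_term hy hπ hψ hψM j),
    hA.integral_term hy hπ hφ hφM, hA.integral_term hy hπ hψ hψM]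
  split_ifs with hij
  · subst hij
    congr 1
    rw [← hA.integral_term hy hπ (φ := fun i x => φ i x * ψ i x) (fun i => (hφ i).mul (hψ i))
      (fun i => hprodM i i) i]
    congr 1
    ext ω
    simp only [Pi.mul_apply]
    split_ifs <;> simp
  · have h2 := hA.integral_subset hy hπ {i, j} (φ := fun x => φ i (x i) * ψ j (x j))
      (((hφ i).comp (measurable_pi_apply i)).mul ((hψ j).comp (measurable_pi_apply j)))
      (integrable_of_ae_abs_le ((hmφ i).mul (hmψ j)) (hprodM i j))
    have e1 : (fun ω => (if i ∈ A ω then φ i (y i ω, π i ω) else 0)) *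
        (fun ω => if j ∈ A ω then ψ j (y j ω, π j ω) else 0) =
        fun ω => if {i, j} ⊆ A ω then φ i (y i ω, π i ω) * ψ j (y j ω, π j ω) else 0 := by
      ext ω
      simp only [Pi.mul_apply, Finset.insert_subset_iff, Finset.singleton_subset_iff]
      by_cases h1 : i ∈ A ω <;> by_cases h2 : j ∈ A ω <;> simp [h1, h2]
    rw [e1, h2, sub_eq_zero]
    have hind := (hindep.indepFun hij).comp
      (φ := fun x : Fin K × unitInterval => (x.2 : ℝ) * φ i x)
      (ψ := fun x : Fin K × unitInterval => (x.2 : ℝ) * ψ j x)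
      ((measurable_subtype_coe.comp measurable_snd).mul (hφ i))
      ((measurable_subtype_coe.comp measurable_snd).mul (hψ j))
    have hfac := hind.integral_fun_mul_eq_mul_integral
      (((measurable_subtype_coe.comp (hπ i)).mul (hmφ i)).aestronglyMeasurable)
      (((measurable_subtype_coe.comp (hπ j)).mul (hmψ j)).aestronglyMeasurable)
    simp only [Function.comp_apply] at hfac
    rw [← hfac]
    congr 1
    ext ω
    rw [Finset.prod_pair hij]
    ring

theorem sum_mem_eq_sum_ite (A : Finset (Fin N)) (u : Fin N → ℝ) :
    ∑ i ∈ A, u i = ∑ i, if i ∈ A then u i else 0 := by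
  rw [Finset.sum_ite_mem, Finset.univ_inter]

theorem IsPoissonSample.covariance_sum (hA : IsPoissonSample P y π A)
    (hy : ∀ i, Measurable (y i)) (hπ : ∀ i, Measurable (π i))
    (hindep : iIndepFun (fun i ω => (y i ω, π i ω)) P)
    (hφ : ∀ i, Measurable (φ i)) (hψ : ∀ i, Measurable (ψ i))
    (hφM : ∀ i, ∀ᵐ ω ∂P, |φ i (y i ω, π i ω)| ≤ M)
    (hψM : ∀ i, ∀ᵐ ω ∂P, |ψ i (y i ω, π i ω)| ≤ M) :
    covariance (fun ω => ∑ i ∈ A ω, φ i (y i ω, π i ω))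
      (fun ω => ∑ i ∈ A ω, ψ i (y i ω, π i ω)) P =
    ∑ i, (∫ ω, (π i ω : ℝ) * (φ i (y i ω, π i ω) * ψ i (y i ω, π i ω)) ∂P -
      (∫ ω, (π i ω : ℝ) * φ i (y i ω, π i ω) ∂P) * ∫ ω, (π i ω : ℝ) * ψ i (y i ω, π i ω) ∂P) := by
  simp_rw [fun ω => sum_mem_eq_sum_ite (A ω) fun i => φ i (y i ω, π i ω),
    fun ω => sum_mem_eq_sum_ite (A ω) fun i => ψ i (y i ω, π i ω)]
  rw [covariance_fun_sum_fun_sum (hA.memLp_term hy hπ hφ hφM) (hA.memLp_term hy hπ hψ hψM)]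
  simp_rw [hA.covariance_term hy hπ hindep hφ hψ hφM hψM]
  simp

theorem IsPoissonSample.memLp_sum (hA : IsPoissonSample P y π A)
    (hy : ∀ i, Measurable (y i)) (hπ : ∀ i, Measurable (π i)) (hφ : ∀ i, Measurable (φ i))
    (hφM : ∀ i, ∀ᵐ ω ∂P, |φ i (y i ω, π i ω)| ≤ M) :
    MemLp (fun ω => ∑ i ∈ A ω, φ i (y i ω, π i ω)) 2 P := by
  simp_rw [fun ω => sum_mem_eq_sum_ite (A ω) fun i => φ i (y i ω, π i ω)]
  exact memLp_finsetSum _ fun i _ => hA.memLp_term hy hπ hφ hφM i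

theorem IsPoissonSample.integral_sum (hA : IsPoissonSample P y π A)
    (hy : ∀ i, Measurable (y i)) (hπ : ∀ i, Measurable (π i)) (hφ : ∀ i, Measurable (φ i))
    (hφM : ∀ i, ∀ᵐ ω ∂P, |φ i (y i ω, π i ω)| ≤ M) :
    ∫ ω, ∑ i ∈ A ω, φ i (y i ω, π i ω) ∂P = ∑ i, ∫ ω, (π i ω : ℝ) * φ i (y i ω, π i ω) ∂P := by
  simp_rw [fun ω => sum_mem_eq_sum_ite (A ω) fun i => φ i (y i ω, π i ω)]
  rw [integral_finsetSum _ fun i _ => (hA.memLp_term hy hπ hφ hφM i).integrable (by norm_num)]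
  exact Finset.sum_congr rfl fun i _ => hA.integral_term hy hπ hφ hφM i

/-- The variance of a sum over a Poisson sample is at most `M² n₀`, if the terms are bounded by
`M`. -/
theorem IsPoissonSample.variance_sum_le (hA : IsPoissonSample P y π A)
    (hy : ∀ i, Measurable (y i)) (hπ : ∀ i, Measurable (π i))
    (hindep : iIndepFun (fun i ω => (y i ω, π i ω)) P) (hφ : ∀ i, Measurable (φ i))
    (hφM : ∀ i, ∀ᵐ ω ∂P, |φ i (y i ω, π i ω)| ≤ M) :
    variance (fun ω => ∑ i ∈ A ω, φ i (y i ω, π i ω)) P ≤ M ^ 2 * expectedSize P π := by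
  rw [← covariance_self (hA.memLp_sum hy hπ hφ hφM).aemeasurable,
    hA.covariance_sum hy hπ hindep hφ hφ hφM hφM, expectedSize, Finset.mul_sum]
  refine Finset.sum_le_sum fun i _ => ?_
  have hπm : Measurable fun ω => (π i ω : ℝ) := measurable_subtype_coe.comp (hπ i)
  have hm : Measurable fun ω => φ i (y i ω, π i ω) := (hφ i).comp ((hy i).prodMk (hπ i))
  have hi : Integrable (fun ω => (π i ω : ℝ)) P := integrable_of_ae_abs_le (M := 1) hπm
    (ae_of_all _ fun ω => by rw [abs_of_nonneg (π i ω).2.1]; exact (π i ω).2.2)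
  have hbd : ∀ᵐ ω ∂P, (π i ω : ℝ) * (φ i (y i ω, π i ω) * φ i (y i ω, π i ω)) ≤
      M ^ 2 * (π i ω : ℝ) := by
    filter_upwards [hφM i] with ω h
    rw [mul_comm]
    refine mul_le_mul_of_nonneg_right ?_ (π i ω).2.1
    rw [← sq, ← sq_abs]
    exact pow_le_pow_left₀ (abs_nonneg _) h 2
  have hi2 : Integrable (fun ω => (π i ω : ℝ) * (φ i (y i ω, π i ω) * φ i (y i ω, π i ω))) P := by
    refine Integrable.mono' (hi.const_mul (M ^ 2)) (hπm.mul (hm.mul hm)).aestronglyMeasurable ?_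
    filter_upwards [hbd] with ω h
    rwa [Real.norm_of_nonneg (mul_nonneg (π i ω).2.1 (mul_self_nonneg _))]
  have h1 := integral_mono_ae hi2 (hi.const_mul (M ^ 2)) hbd
  rw [integral_const_mul] at h1
  have h2 := mul_self_nonneg (∫ ω, (π i ω : ℝ) * φ i (y i ω, π i ω) ∂P)
  linarith

end

/-- A law of large numbers for sums over Poisson samples with terms of order `1 / n₀`. -/
theorem tendsto_measure_sum_sub_ge {Ω : ℕ → Type*} [∀ t, MeasurableSpace (Ω t)]
    {P : ∀ t, Measure (Ω t)} [∀ t, IsProbabilityMeasure (P t)] {N : ℕ → ℕ} {K : ℕ}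
    {y : ∀ t, Fin (N t) → Ω t → Fin K} {π : ∀ t, Fin (N t) → Ω t → unitInterval}
    {A : ∀ t, Ω t → Finset (Fin (N t))}
    (hy : ∀ t i, Measurable (y t i)) (hπ : ∀ t i, Measurable (π t i))
    (hindep : ∀ t, iIndepFun (fun i ω => (y t i ω, π t i ω)) (P t))
    (hsample : ∀ t, IsPoissonSample (P t) (y t) (π t) (A t))
    (hn₀ : Tendsto (fun t => expectedSize (P t) (π t)) atTop atTop)
    {φ : ∀ t, Fin (N t) → Fin K × unitInterval → ℝ} (hφ : ∀ t i, Measurable (φ t i)) {M : ℝ}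
    (hM : ∀ᶠ t in atTop, ∀ i, ∀ᵐ ω ∂(P t),
      |φ t i (y t i ω, π t i ω)| ≤ M / expectedSize (P t) (π t))
    {c : ℝ} (hc : Tendsto (fun t => ∑ i, ∫ ω, (π t i ω : ℝ) * φ t i (y t i ω, π t i ω) ∂(P t))
      atTop (𝓝 c)) {ε : ℝ} (hε : 0 < ε) :
    Tendsto (fun t => P t {ω | ε ≤ |∑ i ∈ A t ω, φ t i (y t i ω, π t i ω) - c|}) atTop (𝓝 0) := by
  -- Chebyshev with variance at most (M / n₀)² n₀ = M² / n₀; the other half of `ε` absorbs the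
  -- distance of the mean from `c`.
  have hlim : Tendsto (fun t => ENNReal.ofReal (M ^ 2 / expectedSize (P t) (π t) / (ε / 2) ^ 2))
      atTop (𝓝 0) := by
    have := (hn₀.const_div_atTop (M ^ 2)).div_const ((ε / 2) ^ 2)
    rw [zero_div] at this
    simpa using ENNReal.tendsto_ofReal this
  refine tendsto_of_tendsto_of_tendsto_of_le_of_le' tendsto_const_nhds hlim
    (Eventually.of_forall fun t => zero_le) ?_
  have hc' : ∀ᶠ t in atTop, |∑ i, ∫ ω, (π t i ω : ℝ) * φ t i (y t i ω, π t i ω) ∂(P t) - c| <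
      ε / 2 := by
    have := (hc.sub_const c).abs
    rw [sub_self, abs_zero] at this
    exact this.eventually (gt_mem_nhds (half_pos hε))
  filter_upwards [hM, hc', hn₀.eventually_gt_atTop 0] with t h1 h2 h3
  have hmem := (hsample t).memLp_sum (hy t) (hπ t) (hφ t) h1
  have hvar := (hsample t).variance_sum_le (hy t) (hπ t) (hindep t) (hφ t) h1
  rw [← (hsample t).integral_sum (hy t) (hπ t) (hφ t) h1] at h2
  calc _ ≤ P t {ω | ε / 2 ≤ |∑ i ∈ A t ω, φ t i (y t i ω, π t i ω) -
        ∫ ω, ∑ i ∈ A t ω, φ t i (y t i ω, π t i ω) ∂(P t)|} := by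
        refine measure_mono fun ω hω => ?_
        simp only [Set.mem_ofPred_eq] at hω ⊢
        have := abs_sub_le (∑ i ∈ A t ω, φ t i (y t i ω, π t i ω))
          (∫ ω, ∑ i ∈ A t ω, φ t i (y t i ω, π t i ω) ∂(P t)) c
        linarith
    _ ≤ _ := meas_ge_le_variance_div_sq hmem (half_pos hε)
    _ ≤ _ := by
        refine ENNReal.ofReal_le_ofReal ?_
        gcongr
        refine hvar.trans_eq ?_
        field_simp

/-! ### Convergence in probability from convergence along sequences of samples -/

/-- If the random quantities `Q_j` converge to constants in probability and `F` converges along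
every sequence of sample points along which the `Q_j` converge, then `F` converges in
probability. -/
theorem tendsto_measure_of_forall_seq {Ω : ℕ → Type*} [∀ t, MeasurableSpace (Ω t)]
    {P : ∀ t, Measure (Ω t)} {B : ∀ t, Ω t → Prop} (hB : ∀ᶠ t in atTop, ∀ᵐ ω ∂(P t), B t ω)
    {ι : Type*} [Fintype ι] {Q : ι → ∀ t, Ω t → ℝ} {c : ι → ℝ}
    (hQ : ∀ j, ∀ ε > 0, Tendsto (fun t => P t {ω | ε ≤ |Q j t ω - c j|}) atTop (𝓝 0))
    {F : ∀ t, Ω t → ℝ} {b : ℝ}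
    (hF : ∀ (τ : ℕ → ℕ) (x : ∀ m, Ω (τ m)), Tendsto τ atTop atTop → (∀ m, B (τ m) (x m)) →
      (∀ j, Tendsto (fun m => Q j (τ m) (x m)) atTop (𝓝 (c j))) →
      Tendsto (fun m => F (τ m) (x m)) atTop (𝓝 b)) {ε : ℝ} (hε : 0 < ε) :
    Tendsto (fun t => P t {ω | ε ≤ |F t ω - b|}) atTop (𝓝 0) := by
  -- Otherwise each `m` supplies a population index at least `m` and a sample point where all `Q j`
  -- are within 1 / (m + 1) of their limits but `F` is at distance at least `ε` from `b`,
  -- contradicting `hF`.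
  obtain ⟨m, hm⟩ : ∃ m : ℕ, ∀ t ≥ m, ∀ ω, B t ω →
      (∀ j, |Q j t ω - c j| < 1 / ((m : ℝ) + 1)) → |F t ω - b| < ε := by
    by_contra! hcon
    choose τ hτ x hxB hxQ hxF using hcon
    have hτ' : Tendsto τ atTop atTop := tendsto_atTop_mono hτ tendsto_id
    have := hF τ x hτ' hxB fun j => by
      rw [tendsto_iff_norm_sub_tendsto_zero]
      exact squeeze_zero (fun m => norm_nonneg _) (fun m => (hxQ m j).le)
        tendsto_one_div_add_atTop_nhds_zero_nat
    have h2 := (this.sub_const b).abs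
    rw [sub_self, abs_zero] at h2
    obtain ⟨m, hm⟩ := (h2.eventually (gt_mem_nhds hε)).exists
    exact (hxF m).not_gt hm
  have hδ : (0 : ℝ) < 1 / ((m : ℝ) + 1) := by positivity
  have hsum := tendsto_finsetSum Finset.univ fun j _ => hQ j _ hδ
  simp only [Finset.sum_const_zero] at hsum
  refine tendsto_of_tendsto_of_tendsto_of_le_of_le' tendsto_const_nhds hsum
    (Eventually.of_forall fun t => zero_le) ?_
  filter_upwards [hB, eventually_ge_atTop m] with t ht htm
  calc P t {ω | ε ≤ |F t ω - b|}
      ≤ P t ({ω | ¬ B t ω} ∪ ⋃ j ∈ (Finset.univ : Finset ι),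
          {ω | 1 / ((m : ℝ) + 1) ≤ |Q j t ω - c j|}) := by
        refine measure_mono fun ω hω => ?_
        by_contra hcon
        simp only [Set.mem_union, Set.mem_ofPred_eq, not_or, not_not, Set.mem_iUnion, not_exists,
          not_le, Finset.mem_univ, true_implies] at hcon hω
        exact hω.not_gt (hm t htm ω hcon.1 hcon.2)
    _ ≤ P t {ω | ¬ B t ω} + ∑ j, P t {ω | 1 / ((m : ℝ) + 1) ≤ |Q j t ω - c j|} :=
        (measure_union_le _ _).trans (add_le_add le_rfl (measure_biUnion_finset_le _ _))
    _ = ∑ j, P t {ω | 1 / ((m : ℝ) + 1) ≤ |Q j t ω - c j|} := by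
        rw [ae_iff.1 ht, zero_add]

/-! ### The limits for Poisson samples -/

theorem measurable_indicator_fst {K : ℕ} (k : Fin K) :
    Measurable fun x : Fin K × unitInterval => if x.1 = k then (1 : ℝ) else 0 :=
  (Measurable.of_discrete (f := fun a : Fin K => if a = k then (1 : ℝ) else 0)).comp measurable_fst

theorem measurable_inv_snd {K : ℕ} :
    Measurable fun x : Fin K × unitInterval => (x.2 : ℝ)⁻¹ :=
  (measurable_subtype_coe.comp measurable_snd).inv

theorem pos_and_inv_le_of_le_mul {N : ℕ} {n₀ C : ℝ} (hC : 0 < C)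
    {π : unitInterval} (h : C ≤ N / n₀ * (π : ℝ)) :
    0 < (π : ℝ) ∧ (π : ℝ)⁻¹ ≤ C⁻¹ * (N / n₀) := by
  have hpos : 0 < (π : ℝ) := by
    refine lt_of_le_of_ne π.2.1 fun h0 => ?_
    rw [← h0, mul_zero] at h
    exact h.not_gt hC
  refine ⟨hpos, ?_⟩
  rw [inv_mul_eq_div, le_div_iff₀ hC, inv_mul_le_iff₀ hpos]
  linarith

section

variable {d : ℕ} {p : Fin (d + 1) → ℝ} {Ω : ℕ → Type*} [∀ t, MeasurableSpace (Ω t)]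
  {P : ∀ t, Measure (Ω t)} [∀ t, IsProbabilityMeasure (P t)] {N : ℕ → ℕ}
  {y : ∀ t, Fin (N t) → Ω t → Fin (d + 1)} {π : ∀ t, Fin (N t) → Ω t → unitInterval}
  {A : ∀ t, Ω t → Finset (Fin (N t))}

theorem tendsto_measure_size_sub_ge
    (hy : ∀ t i, Measurable (y t i)) (hπ : ∀ t i, Measurable (π t i))
    (hindep : ∀ t, iIndepFun (fun i ω => (y t i ω, π t i ω)) (P t))
    (hsample : ∀ t, IsPoissonSample (P t) (y t) (π t) (A t))
    (hn₀ : Tendsto (fun t => expectedSize (P t) (π t)) atTop atTop) {ε : ℝ} (hε : 0 < ε) :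
    Tendsto (fun t => P t {ω | ε ≤ |(#(A t ω) : ℝ) / expectedSize (P t) (π t) - 1|}) atTop
      (𝓝 0) := by
  have h := tendsto_measure_sum_sub_ge hy hπ hindep hsample hn₀
    (φ := fun t _ _ => 1 / expectedSize (P t) (π t)) (fun _ _ => measurable_const) (M := 1)
    (by
      filter_upwards [hn₀.eventually_gt_atTop 0] with t ht i
      exact ae_of_all _ fun ω => (abs_of_nonneg (by positivity)).le) (c := 1)
    (by
      refine tendsto_const_nhds.congr' ?_
      filter_upwards [hn₀.eventually_gt_atTop 0] with t ht
      simp_rw [integral_mul_const]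
      rw [← Finset.sum_mul, ← expectedSize, mul_one_div_cancel ht.ne']) hε
  simpa only [Finset.sum_const, nsmul_eq_mul, mul_one_div] using h

/-- The weight cancels the inclusion probability, so the mean of the weighted count is the expected
population proportion, whose limit is given by the null hypothesis. -/
theorem tendsto_measure_weight_sub_ge
    (hy : ∀ t i, Measurable (y t i)) (hπ : ∀ t i, Measurable (π t i))
    (hindep : ∀ t, iIndepFun (fun i ω => (y t i ω, π t i ω)) (P t))
    (hsample : ∀ t, IsPoissonSample (P t) (y t) (π t) (A t))
    (hn₀ : Tendsto (fun t => expectedSize (P t) (π t)) atTop atTop)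
    {C : ℝ} (hC : 0 < C)
    (hbound : ∀ t i, ∀ᵐ ω ∂(P t), C ≤ N t / expectedSize (P t) (π t) * (π t i ω : ℝ))
    (hnull : ∀ k, Tendsto (fun t => (∑ i, (P t).real {ω | y t i ω = k}) / N t) atTop (𝓝 (p k)))
    (k : Fin (d + 1)) {ε : ℝ} (hε : 0 < ε) :
    Tendsto (fun t => P t {ω | ε ≤ |(∑ i ∈ A t ω with y t i ω = k,
      samplingWeight (fun i => π t i ω) i) / N t - p k|}) atTop (𝓝 0) := by
  have h := tendsto_measure_sum_sub_ge hy hπ hindep hsample hn₀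
    (φ := fun t _ x => (x.2 : ℝ)⁻¹ * (if x.1 = k then 1 else 0) / N t)
    (fun _ _ => (measurable_inv_snd.mul (measurable_indicator_fst k)).div_const _) (M := C⁻¹)
    (by
      filter_upwards [hn₀.eventually_gt_atTop 0] with t ht i
      filter_upwards [hbound t i] with ω hω
      have hN : (0 : ℝ) < N t := Nat.cast_pos.2 (Fin.pos i)
      obtain ⟨h1, h2⟩ := pos_and_inv_le_of_le_mul hC hω
      have h3 : C⁻¹ / expectedSize (P t) (π t) =
        C⁻¹ * (N t / expectedSize (P t) (π t)) * 1 / N t := by field_simp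
      rw [abs_of_nonneg (div_nonneg (mul_nonneg (inv_nonneg.2 h1.le) (by split_ifs <;> simp))
        hN.le), h3]
      gcongr
      split_ifs <;> simp) (c := p k)
    (by
      refine (hnull k).congr' ?_
      filter_upwards [hn₀.eventually_gt_atTop 0] with t ht
      rw [Finset.sum_div]
      refine Finset.sum_congr rfl fun i _ => ?_
      have hset : MeasurableSet {ω | y t i ω = k} := hy t i (measurableSet_singleton k)
      rw [← integral_indicator_one hset, ← integral_div]
      refine integral_congr_ae ?_
      filter_upwards [hbound t i] with ω hω
      have h1 := (pos_and_inv_le_of_le_mul hC hω).1.ne'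
      rw [mul_div_assoc, mul_inv_cancel_left₀ h1]
      by_cases hk : y t i ω = k
      · rw [Set.indicator_of_mem (s := {ω | y t i ω = k}) hk, if_pos hk]; rfl
      · rw [Set.indicator_of_notMem (s := {ω | y t i ω = k}) hk, if_neg hk]) hε
  refine h.congr fun t => ?_
  congr 1
  ext ω
  simp only [Set.mem_ofPred_eq, Finset.sum_filter, Finset.sum_div, samplingWeight, mul_ite, mul_one,
    mul_zero]

/-- The terms of the linearized error. -/
def errorTerm {K : ℕ} (p : Fin K → ℝ) (N : ℕ) (k : Fin K) (x : Fin K × unitInterval) : ℝ :=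
  (N : ℝ)⁻¹ * ((x.2 : ℝ)⁻¹ * ((if x.1 = k then 1 else 0) - p k))

theorem measurable_errorTerm {K : ℕ} (p : Fin K → ℝ) (N : ℕ) (k : Fin K) :
    Measurable (errorTerm p N k) :=
  (measurable_inv_snd.mul ((measurable_indicator_fst k).sub_const _)).const_mul _

theorem linearizedError_eq {K N : ℕ} (p : Fin K → ℝ) (A : Finset (Fin N)) (y : Fin N → Fin K)
    (π : Fin N → unitInterval) (k : Fin K) :
    linearizedError p A y π k = ∑ i ∈ A, errorTerm p N k (y i, π i) := by
  rw [linearizedError, Finset.mul_sum]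
  rfl

theorem abs_errorTerm_le {N : ℕ} {n₀ C : ℝ} (hN : N ≠ 0) (hn₀ : 0 < n₀) (hC : 0 < C)
    (hp : ∀ k, 0 ≤ p k) (hp1 : ∀ k, p k ≤ 1) (k y : Fin (d + 1)) {π : unitInterval}
    (h : C ≤ N / n₀ * (π : ℝ)) : |errorTerm p N k (y, π)| ≤ C⁻¹ / n₀ := by
  obtain ⟨h1, h2⟩ := pos_and_inv_le_of_le_mul hC h
  have hN' : (0 : ℝ) < N := Nat.cast_pos.2 (Nat.pos_of_ne_zero hN)
  rw [errorTerm, abs_mul, abs_mul, abs_of_pos (inv_pos.2 hN'), abs_of_pos (inv_pos.2 h1)]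
  calc _ ≤ (N : ℝ)⁻¹ * (C⁻¹ * (N / n₀) * 1) := by
        gcongr
        exact abs_indicator_sub_le (hp k) (hp1 k) _
    _ = C⁻¹ / n₀ := by field_simp

/-- Here π π⁻¹ ≤ 1 also when π = 0, so no lower bound on π is needed. -/
theorem abs_mul_errorTerm_le {N : ℕ} (hp : ∀ k, 0 ≤ p k) (hp1 : ∀ k, p k ≤ 1)
    (k y : Fin (d + 1)) (π : unitInterval) : |(π : ℝ) * errorTerm p N k (y, π)| ≤ (N : ℝ)⁻¹ := by
  have h0 : (0 : ℝ) ≤ (N : ℝ)⁻¹ := by positivity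
  have h1 : 0 ≤ (π : ℝ) * (π : ℝ)⁻¹ := mul_nonneg π.2.1 (inv_nonneg.2 π.2.1)
  have : (π : ℝ) * errorTerm p N k (y, π) =
      (N : ℝ)⁻¹ * (((π : ℝ) * (π : ℝ)⁻¹) * ((if y = k then 1 else 0) - p k)) := by
    rw [errorTerm]; ring
  rw [this, abs_mul, abs_mul, abs_of_nonneg h0, abs_of_nonneg h1]
  calc _ ≤ (N : ℝ)⁻¹ * (1 * 1) := by
        gcongr
        · exact mul_inv_le_one
        · exact abs_indicator_sub_le (hp k) (hp1 k) _
    _ = (N : ℝ)⁻¹ := by ring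

/-- The limit of the expectation of `errorMoment` is the limiting covariance of the linearized
errors. -/
theorem tendsto_mean_errorMoment
    (hy : ∀ t i, Measurable (y t i)) (hπ : ∀ t i, Measurable (π t i))
    (hindep : ∀ t, iIndepFun (fun i ω => (y t i ω, π t i ω)) (P t))
    (hsample : ∀ t, IsPoissonSample (P t) (y t) (π t) (A t))
    (hn₀ : Tendsto (fun t => expectedSize (P t) (π t)) atTop atTop)
    (hn₀N : Tendsto (fun t => expectedSize (P t) (π t) / N t) atTop (𝓝 0))
    {C : ℝ} (hC : 0 < C)
    (hbound : ∀ t i, ∀ᵐ ω ∂(P t), C ≤ N t / expectedSize (P t) (π t) * (π t i ω : ℝ))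
    (hp : ∀ k, 0 ≤ p k) (hp1 : ∀ k, p k ≤ 1) (k l : Fin (d + 1)) {s : ℝ}
    (hs : Tendsto (fun t => expectedSize (P t) (π t) *
        covariance
          (fun ω => linearizedError p (A t ω) (fun i => y t i ω) (fun i => π t i ω) k)
          (fun ω => linearizedError p (A t ω) (fun i => y t i ω) (fun i => π t i ω) l) (P t))
      atTop (𝓝 s)) :
    Tendsto (fun t => ∑ i, ∫ ω, (π t i ω : ℝ) * (expectedSize (P t) (π t) *
      (errorTerm p (N t) k (y t i ω, π t i ω) * errorTerm p (N t) l (y t i ω, π t i ω))) ∂(P t))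
      atTop (𝓝 s) := by
  -- The mean of the error moment exceeds the scaled covariance by these products of means. Each
  -- mean is at most 1 / N, so the total is at most n₀ N N⁻² = n₀ / N.
  have hrem : Tendsto (fun t => expectedSize (P t) (π t) * ∑ i,
      (∫ ω, (π t i ω : ℝ) * errorTerm p (N t) k (y t i ω, π t i ω) ∂(P t)) *
      ∫ ω, (π t i ω : ℝ) * errorTerm p (N t) l (y t i ω, π t i ω) ∂(P t)) atTop (𝓝 0) := by
    refine squeeze_zero_norm' ?_ hn₀N
    filter_upwards [hn₀.eventually_gt_atTop 0] with t ht
    have hint : ∀ k i, |∫ ω, (π t i ω : ℝ) * errorTerm p (N t) k (y t i ω, π t i ω) ∂(P t)| ≤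
        (N t : ℝ)⁻¹ := by
      intro k i
      have := norm_integral_le_of_norm_le_const (μ := P t)
        (f := fun ω => (π t i ω : ℝ) * errorTerm p (N t) k (y t i ω, π t i ω))
        (ae_of_all _ fun ω => abs_mul_errorTerm_le (N := N t) hp hp1 k (y t i ω) (π t i ω))
      simpa using this
    rw [norm_mul, Real.norm_of_nonneg ht.le, div_eq_mul_inv]
    refine mul_le_mul_of_nonneg_left ?_ ht.le
    calc _ ≤ ∑ i : Fin (N t), (N t : ℝ)⁻¹ * (N t : ℝ)⁻¹ := by
          refine (Finset.abs_sum_le_sum_abs _ _).trans (Finset.sum_le_sum fun i _ => ?_)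
          rw [abs_mul]
          exact mul_le_mul (hint k i) (hint l i) (abs_nonneg _) (by positivity)
      _ ≤ (N t : ℝ)⁻¹ := by
          rw [Finset.sum_const, Finset.card_univ, Fintype.card_fin, nsmul_eq_mul, ← mul_assoc]
          exact mul_le_of_le_one_left (by positivity) mul_inv_le_one
  have := hs.add hrem
  rw [add_zero] at this
  refine this.congr' ?_
  filter_upwards [hn₀.eventually_gt_atTop 0] with t ht
  have hbd : ∀ k i, ∀ᵐ ω ∂(P t), |errorTerm p (N t) k (y t i ω, π t i ω)| ≤
      C⁻¹ / expectedSize (P t) (π t) := by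
    intro k i
    filter_upwards [hbound t i] with ω hω
    exact abs_errorTerm_le (Fin.pos i).ne' ht hC hp hp1 k _ hω
  simp_rw [linearizedError_eq]
  rw [(hsample t).covariance_sum (hy t) (hπ t) (hindep t)
    (φ := fun _ => errorTerm p (N t) k) (ψ := fun _ => errorTerm p (N t) l)
    (fun _ => measurable_errorTerm p _ k) (fun _ => measurable_errorTerm p _ l) (hbd k) (hbd l),
    ← mul_add, ← Finset.sum_add_distrib, Finset.mul_sum]
  refine Finset.sum_congr rfl fun i _ => ?_
  rw [sub_add_cancel, ← integral_const_mul]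
  congr 1
  ext ω
  ring

theorem tendsto_measure_errorMoment_sub_ge
    (hy : ∀ t i, Measurable (y t i)) (hπ : ∀ t i, Measurable (π t i))
    (hindep : ∀ t, iIndepFun (fun i ω => (y t i ω, π t i ω)) (P t))
    (hsample : ∀ t, IsPoissonSample (P t) (y t) (π t) (A t))
    (hn₀ : Tendsto (fun t => expectedSize (P t) (π t)) atTop atTop)
    (hn₀N : Tendsto (fun t => expectedSize (P t) (π t) / N t) atTop (𝓝 0))
    {C : ℝ} (hC : 0 < C)
    (hbound : ∀ t i, ∀ᵐ ω ∂(P t), C ≤ N t / expectedSize (P t) (π t) * (π t i ω : ℝ))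
    (hp : ∀ k, 0 ≤ p k) (hp1 : ∀ k, p k ≤ 1) (k l : Fin (d + 1)) {s : ℝ}
    (hs : Tendsto (fun t => expectedSize (P t) (π t) *
        covariance
          (fun ω => linearizedError p (A t ω) (fun i => y t i ω) (fun i => π t i ω) k)
          (fun ω => linearizedError p (A t ω) (fun i => y t i ω) (fun i => π t i ω) l) (P t))
      atTop (𝓝 s)) {ε : ℝ} (hε : 0 < ε) :
    Tendsto (fun t => P t {ω | ε ≤ |errorMoment (expectedSize (P t) (π t)) (A t ω)
      (fun i => y t i ω) (fun i => π t i ω) p k l - s|}) atTop (𝓝 0) := by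
  have h := tendsto_measure_sum_sub_ge hy hπ hindep hsample hn₀
    (φ := fun t _ x => expectedSize (P t) (π t) * (errorTerm p (N t) k x * errorTerm p (N t) l x))
    (fun t _ => ((measurable_errorTerm p _ k).mul (measurable_errorTerm p _ l)).const_mul _)
    (M := C⁻¹ * C⁻¹)
    (by
      filter_upwards [hn₀.eventually_gt_atTop 0] with t ht i
      filter_upwards [hbound t i] with ω hω
      have h1 := abs_errorTerm_le (Fin.pos i).ne' ht hC hp hp1 k (y t i ω) hω
      have h2 := abs_errorTerm_le (Fin.pos i).ne' ht hC hp hp1 l (y t i ω) hω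
      rw [abs_mul, abs_mul, abs_of_pos ht]
      calc _ ≤ expectedSize (P t) (π t) *
            (C⁻¹ / expectedSize (P t) (π t) * (C⁻¹ / expectedSize (P t) (π t))) := by gcongr
        _ = _ := by field_simp)
    (tendsto_mean_errorMoment hy hπ hindep hsample hn₀ hn₀N hC hbound hp hp1 k l hs) hε
  refine h.congr fun t => ?_
  congr 1
  ext ω
  rw [Set.mem_ofPred_eq, Set.mem_ofPred_eq, errorMoment]
  have : ∀ i, expectedSize (P t) (π t) * (errorTerm p (N t) k (y t i ω, π t i ω) *
      errorTerm p (N t) l (y t i ω, π t i ω)) = expectedSize (P t) (π t) / N t ^ 2 *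
      samplingWeight (fun i => π t i ω) i ^ 2 * (((if y t i ω = k then 1 else 0) - p k) *
      ((if y t i ω = l then 1 else 0) - p l)) := by
    intro i
    simp only [errorTerm, samplingWeight, div_eq_mul_inv]
    ring
  rw [Finset.sum_congr rfl fun i _ => this i]

/-- The limiting covariance matrix of the linearized errors is positive semidefinite. -/
theorem quadraticForm_limitCovariance_nonneg
    (hy : ∀ t i, Measurable (y t i)) (hπ : ∀ t i, Measurable (π t i))
    (hsample : ∀ t, IsPoissonSample (P t) (y t) (π t) (A t))
    (hn₀ : Tendsto (fun t => expectedSize (P t) (π t)) atTop atTop)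
    {C : ℝ} (hC : 0 < C)
    (hbound : ∀ t i, ∀ᵐ ω ∂(P t), C ≤ N t / expectedSize (P t) (π t) * (π t i ω : ℝ))
    (hp : ∀ k, 0 ≤ p k) (hp1 : ∀ k, p k ≤ 1) {S : Matrix (Fin d) (Fin d) ℝ}
    (hS : ∀ k l : Fin d, Tendsto (fun t => expectedSize (P t) (π t) *
        covariance
          (fun ω => linearizedError p (A t ω) (fun i => y t i ω) (fun i => π t i ω) k.castSucc)
          (fun ω => linearizedError p (A t ω) (fun i => y t i ω) (fun i => π t i ω) l.castSucc)
          (P t)) atTop (𝓝 (S k l))) (u : Fin d → ℝ) :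
    0 ≤ ∑ k, ∑ l, u k * u l * S k l := by
  have hlim := tendsto_finsetSum Finset.univ fun k _ => tendsto_finsetSum Finset.univ
    fun l _ => (hS k l).const_mul (u k * u l)
  refine ge_of_tendsto hlim ?_
  filter_upwards [hn₀.eventually_gt_atTop 0] with t ht
  let E : Fin d → Ω t → ℝ := fun k ω =>
    linearizedError p (A t ω) (fun i => y t i ω) (fun i => π t i ω) k.castSucc
  have hmem : ∀ k, MemLp (fun ω => u k * E k ω) 2 (P t) := by
    intro k
    refine MemLp.const_mul ?_ (u k)
    simp only [E, linearizedError_eq]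
    refine (hsample t).memLp_sum (hy t) (hπ t) (φ := fun _ => errorTerm p (N t) k.castSucc)
      (fun _ => measurable_errorTerm p _ _) (M := C⁻¹ / expectedSize (P t) (π t)) fun i => ?_
    filter_upwards [hbound t i] with ω hω
    exact abs_errorTerm_le (Fin.pos i).ne' ht hC hp hp1 _ _ hω
  -- Before the limit, the quadratic form is `n₀` times the variance of a linear combination of the
  -- errors.
  have hvar : ∑ k, ∑ l, u k * u l * (expectedSize (P t) (π t) * covariance (E k) (E l) (P t)) =
      expectedSize (P t) (π t) * variance (fun ω => ∑ k, u k * E k ω) (P t) := by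
    rw [← covariance_self (memLp_finsetSum _ fun k _ => hmem k).aemeasurable,
      covariance_fun_sum_fun_sum hmem hmem, Finset.mul_sum]
    refine Finset.sum_congr rfl fun k _ => ?_
    rw [Finset.mul_sum]
    refine Finset.sum_congr rfl fun l _ => ?_
    rw [covariance_const_mul_left, covariance_const_mul_right]
    ring
  exact hvar ▸ mul_nonneg ht.le (variance_nonneg _ _)

end

end SurveyBootstrap

end

theorem theorem6
    -- the number of categories is `K = d + 1`; `p₀` is the vector specified by the null hypothesis
    {d : ℕ} (p₀ : Fin (d + 1) → ℝ) (hp₀ : ∀ k, 0 < p₀ k) (hp₀_sum : ∑ k, p₀ k = 1)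
    -- a sequence of finite populations: category `y t i` and inclusion probability `π t i`
    -- of unit `i` of the `t`-th population, and the sample `A t`
    {Ω : ℕ → Type*} [∀ t, MeasurableSpace (Ω t)]
    (P : ∀ t, Measure (Ω t)) [∀ t, IsProbabilityMeasure (P t)]
    (N : ℕ → ℕ)
    (y : ∀ t, Fin (N t) → Ω t → Fin (d + 1))
    (π : ∀ t, Fin (N t) → Ω t → unitInterval)
    (A : ∀ t, Ω t → Finset (Fin (N t)))
    (hy : ∀ t i, Measurable (y t i)) (hπ : ∀ t i, Measurable (π t i))
    (hindep : ∀ t, iIndepFun (fun i ω => (y t i ω, π t i ω)) (P t))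
    (hsample : ∀ t, SurveyBootstrap.IsPoissonSample (P t) (y t) (π t) (A t))
    -- conditions on the Poisson design, with `n₀` the expected sample size
    (hn₀ : Tendsto (fun t => SurveyBootstrap.expectedSize (P t) (π t)) atTop atTop)
    (hn₀N : Tendsto (fun t => SurveyBootstrap.expectedSize (P t) (π t) / N t) atTop (𝓝 0))
    (C₁ C₂ : ℝ) (hC₁ : 0 < C₁) (hC₂ : 0 < C₂)
    (hbound : ∀ t i, ∀ᵐ ω ∂(P t),
      C₁ ≤ N t / SurveyBootstrap.expectedSize (P t) (π t) * (π t i ω : ℝ) ∧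
      N t / SurveyBootstrap.expectedSize (P t) (π t) * (π t i ω : ℝ) ≤ C₂)
    -- the null hypothesis: the (expected) population proportions are, in the limit, `p₀`
    (hnull : ∀ k, Tendsto (fun t => (∑ i, (P t).real {ω | y t i ω = k}) / N t) atTop (𝓝 (p₀ k)))
    -- `Sp` is the asymptotic covariance matrix of `√n p̂`
    (Sp : Matrix (Fin d) (Fin d) ℝ)
    (hSp : ∀ k l : Fin d, Tendsto (fun t => SurveyBootstrap.expectedSize (P t) (π t) *
        covariance
          (fun ω => SurveyBootstrap.linearizedError p₀ (A t ω) (fun i => y t i ω)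
            (fun i => π t i ω) k.castSucc)
          (fun ω => SurveyBootstrap.linearizedError p₀ (A t ω) (fun i => y t i ω)
            (fun i => π t i ω) l.castSucc) (P t))
      atTop (𝓝 (Sp k l))) :
    -- `l` lists the eigenvalues of `P₀⁻¹ Sp` in increasing order, with their multiplicities
    ∃ l : Fin d → ℝ, Monotone l ∧
      ((SurveyBootstrap.multinomialCov p₀)⁻¹ * Sp).charpoly
        = ∏ k, (Polynomial.X - Polynomial.C (l k)) ∧
      SurveyBootstrap.TendstoWeaklyInProbability P
        (fun t ω => SurveyBootstrap.bootPearsonLaw (A t ω) (fun i => y t i ω) (fun i => π t i ω))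
        (SurveyBootstrap.weightedChiSq l) ∧
      SurveyBootstrap.TendstoWeaklyInProbability P
        (fun t ω => SurveyBootstrap.bootLRLaw (A t ω) (fun i => y t i ω) (fun i => π t i ω))
        (SurveyBootstrap.weightedChiSq l) := by
  have hbound₁ : ∀ t i, ∀ᵐ ω ∂(P t),
      C₁ ≤ N t / SurveyBootstrap.expectedSize (P t) (π t) * (π t i ω : ℝ) := fun t i => by
    filter_upwards [hbound t i] with ω hω using hω.1
  have hp0 : ∀ k, 0 ≤ p₀ k := fun k => (hp₀ k).le
  have hp1 : ∀ k, p₀ k ≤ 1 := fun k => by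
    rw [← hp₀_sum]; exact Finset.single_le_sum (fun k _ => hp0 k) (Finset.mem_univ k)
  have hsymm : Sp.transpose = Sp := by
    ext k l
    refine tendsto_nhds_unique (hSp l k) ((hSp k l).congr fun t => ?_)
    rw [covariance_comm]
  obtain ⟨l, hl, hchar, G, hG, hGl⟩ := SurveyBootstrap.exists_designEffect_eigenvalues p₀ hp₀
    hp₀_sum Sp hsymm (SurveyBootstrap.quadraticForm_limitCovariance_nonneg hy hπ hsample hn₀ hC₁
      hbound₁ hp0 hp1 hSp)
  -- `Q` collects the random quantities through which the sample determines the limit: relative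
  -- size, category weights and error moments.
  let Q : Unit ⊕ Fin (d + 1) ⊕ (Fin d × Fin d) → ∀ t, Ω t → ℝ :=
    Sum.elim (fun _ t ω => (#(A t ω) : ℝ) / SurveyBootstrap.expectedSize (P t) (π t))
      (Sum.elim (fun k t ω => (∑ i ∈ A t ω with y t i ω = k,
          SurveyBootstrap.samplingWeight (fun i => π t i ω) i) / N t)
        (fun kl t ω => SurveyBootstrap.errorMoment (SurveyBootstrap.expectedSize (P t) (π t))
          (A t ω) (fun i => y t i ω) (fun i => π t i ω) p₀ kl.1.castSucc kl.2.castSucc))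
  let c : Unit ⊕ Fin (d + 1) ⊕ (Fin d × Fin d) → ℝ :=
    Sum.elim (fun _ => 1) (Sum.elim p₀ fun kl => Sp kl.1 kl.2)
  have hQ : ∀ j, ∀ ε > 0, Tendsto (fun t => P t {ω | ε ≤ |Q j t ω - c j|}) atTop (𝓝 0) := by
    rintro (j | k | kl) ε hε
    · exact SurveyBootstrap.tendsto_measure_size_sub_ge hy hπ hindep hsample hn₀ hε
    · exact SurveyBootstrap.tendsto_measure_weight_sub_ge hy hπ hindep hsample hn₀ hC₁ hbound₁
        hnull k hε
    · exact SurveyBootstrap.tendsto_measure_errorMoment_sub_ge hy hπ hindep hsample hn₀ hn₀N hC₁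
        hbound₁ hp0 hp1 _ _ (hSp kl.1 kl.2) hε
  -- The almost sure bounds on the inclusion probabilities must hold pointwise along the chosen
  -- sample points.
  let B : ∀ t, Ω t → Prop := fun t ω => ∀ i, 0 < (π t i ω : ℝ) ∧
    SurveyBootstrap.samplingWeight (fun i => π t i ω) i ≤
      C₁⁻¹ * (N t / SurveyBootstrap.expectedSize (P t) (π t))
  have hB : ∀ᶠ t in atTop, ∀ᵐ ω ∂(P t), B t ω := by
    filter_upwards [hn₀.eventually_gt_atTop 0] with t ht
    filter_upwards [ae_all_iff.2 (hbound₁ t)] with ω hω i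
    exact SurveyBootstrap.pos_and_inv_le_of_le_mul hC₁ (hω i)
  have hlim : ∀ (f : BoundedContinuousFunction ℝ ℝ) (τ : ℕ → ℕ) (x : ∀ m, Ω (τ m)),
      Tendsto τ atTop atTop → (∀ m, B (τ m) (x m)) →
      (∀ j, Tendsto (fun m => Q j (τ m) (x m)) atTop (𝓝 (c j))) →
      Tendsto (fun m => ∫ z, f z ∂(SurveyBootstrap.bootPearsonLaw (A (τ m) (x m))
        (fun i => y (τ m) i (x m)) (fun i => π (τ m) i (x m)))) atTop
        (𝓝 (∫ z, f z ∂(SurveyBootstrap.weightedChiSq l))) ∧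
      Tendsto (fun m => ∫ z, f z ∂(SurveyBootstrap.bootLRLaw (A (τ m) (x m))
        (fun i => y (τ m) i (x m)) (fun i => π (τ m) i (x m)))) atTop
        (𝓝 (∫ z, f z ∂(SurveyBootstrap.weightedChiSq l))) := by
    intro f τ x hτ hxB hxQ
    have h1 := hxQ (Sum.inl ())
    have h2 := fun k => hxQ (Sum.inr (Sum.inl k))
    have h3 := fun k l => hxQ (Sum.inr (Sum.inr (k, l)))
    simp only [Q, c, Sum.elim_inl, Sum.elim_inr] at h1 h2 h3
    exact SurveyBootstrap.tendsto_integral_bootLaws (n₀ := fun m =>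
      SurveyBootstrap.expectedSize (P (τ m)) (π (τ m))) hp₀ hp₀_sum (hn₀.comp hτ)
      (fun m i _ => (hxB m i).1) (fun m i _ => (hxB m i).2) h1 h2 h3 hG hGl f
  refine ⟨l, hl, hchar, fun f ε hε => ?_, fun f ε hε => ?_⟩
  · exact SurveyBootstrap.tendsto_measure_of_forall_seq hB hQ
      (fun τ x hτ hxB hxQ => (hlim f τ x hτ hxB hxQ).1) hε
  · exact SurveyBootstrap.tendsto_measure_of_forall_seq hB hQ
      (fun τ x hτ hxB hxQ => (hlim f τ x hτ hxB hxQ).2) hε
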